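/- **Setting.** A *bi-agent influence diagram* (BAID) is a finite directed graph over decision nodes of a Defender ($D$), decision nodes of an Attacker ($A$), chance nodes (pertinent to one agent or shared by both), and one utility node per agent (without successors). Each non-utility node $v$ takes values in a measurable space $\mathcal X_v$ with a nonzero $\sigma$-finite reference measure, with respect to which densities are taken (so nodes may be discrete or continuous); $\mathrm{ant}(v)$ denotes the direct antecessors of $v$, and the antecessors of a decision node are known when that decision is made. The *ID of an agent* consists of all decision nodes, the chance nodes pertinent to that agent and the agent's utility node; in it the opponent's decisions are chance nodes. The BAID is *proper* if it is acyclic and for each agent: the antecessors of all nodes of the agent's ID lie in that ID; there is a directed path through all the decision nodes of the agent ending in the agent's utility node (DDP $=(D_1,\dots,D_n)$ for the Defender, ADP $=(A_1,\dots,A_m)$ for the Attacker); and there is no forgetting, i.e. each decision of the agent, and its antecessors, are antecessors of all later decisions of that agent. Given are: a positive measurable utility $u_D$ and conditional densities $p_D(x\mid \mathrm{ant}(x))$ at the Defender's chance nodes (none at the Attacker's decisions); on a probability space $(\Omega,\mathcal F,\mathcal P)$, an a.s. positive jointly measurable random utility $U_A$ and random conditional densities $P_A(x\mid\mathrm{ant}(x))$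 at the Attacker's chance nodes and at the Defender's decisions; and, for each $D_i$, a reassessment map assigning to a decision rule $d_i^*(\cdot)$ a new random density $P_A(d_i\mid\mathrm{ant}(D_i))$. **APS reduction.** Consider a partially reduced ID of one agent with current value function $\psi$, last remaining decision node $D$, and conditional distributions not used so far. Let $\mathcal X_c(D)$ be the smallest set containing every remaining chance node unknown at $D$ that is an antecessor of the value node, or that occurs together with $D$ or with a member of $\mathcal X_c(D)$ in some unused conditional distribution (these are the chance nodes that are eliminated before $D$ by arc inversions and chance node removals). The *augmented distribution* is $\pi(d,x_c\mid\cdot)\propto w:=\psi\prod p(x_k\mid\mathrm{ant}(x_k))$, the product being over the unused conditional distributions in which $D$ or a node of $\mathcal X_c(D)$ occurs. The reduction chooses a measurable rule $d^*(\cdot)$ such that $d^*(\cdot)$ is a mode of the marginal of $\pi$ in $d$ for all values of the conditioning variables, removes $D$, $\mathcal X_c(D)$ and the distributions used, and takes $\int w(d^*(\cdot),x_c,\cdot)\,dx_c$ as the new value function; the value node inherits the antecessors that are not eliminated. $\texttt{DAPS\_red}$ is this reduction in the Defender's ID (initially $\psi=u_D$). $\texttt{AAPS\_red}$ is this reduction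 in the Attacker's ID for a.e. $\omega$ (initially $\psi=U_A^\omega$), with a jointly measurable random rule $A^*(\cdot)$, together with the density $p_D(a\mid\cdot)$ of the law of $A^*(\cdot)$ under $\mathcal P$. The reduction is *solvable* if such a rule (and, for the Attacker, such a density) exists. **Algorithm.** While the DDP is nonempty, let $D_i$ be its last node. If all densities needed for $\texttt{DAPS\_red}$ of $D_i$ are available, apply it, store $d_i^*(\cdot)$, replace $P_A(d_i\mid\cdot)$ by its reassessment if it has not yet been used in the Attacker's ID, and delete $D_i$ from the DDP. Otherwise apply $\texttt{AAPS\_red}$ to the last node $A_j$ of the ADP, store $A_j^*(\cdot)$, make $p_D(a_j\mid\cdot)$ available, and delete $A_j$ from the ADP. **Proposition.** For every proper BAID: 1. The algorithm terminates: every run uses at most $n$ $\texttt{DAPS\_red}$ and at most $m$ $\texttt{AAPS\_red}$ operations, and the DDP is empty exactly when $n$ $\texttt{DAPS\_red}$ operations have been made. 2. In every reachable state with nonempty DDP, if the reduction that is due is solvable, then the algorithm can proceed (in particular the ADP is nonempty whenever some needed density is not available). 3. If all decision sets are finite (with measurable singletons of positive reference measure), the reduction that is due is always solvable, so the algorithm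 always runs to completion. 4. Whenever the DDP has become empty, the stored rules $(d_1^*,\dots,d_n^*)$ form an optimal policy of the Defender from the ARA perspective. That is: (a) for a.e. $\omega$, the stored random rules $A_j^{*\omega}$ are optimal for the Attacker's ID with utility $U_A^\omega$ and random probabilities $P_A^\omega$ (with the reassessed beliefs where they were replaced): replacing the corresponding rules of any Attacker policy by the $A_j^{*\omega}$ does not decrease his expected utility; (b) $p_D(a_j\mid\cdot)$ is the density of $A_j^*(\cdot)$ for each such $j$; and (c) with the given $p_D$ at the chance nodes, these $p_D(a_j\mid\cdot)$, and arbitrary conditional densities at those Attacker decisions that were not reduced, $(d_1^*,\dots,d_n^*)$ maximises the Defender's expected utility (with values in $[0,\infty]$) among all measurable policies; moreover, for every $i$ and every policy, replacing its rules at $D_i,\dots,D_n$ by $d_i^*,\dots,d_n^*$ does not decrease her expected utility. -/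

import Mathlib

open MeasureTheory
open scoped ENNReal NNReal

noncomputable section

/-- The two decision makers. -/
inductive Agent where
  | defender
  | attacker

/-- Kinds of the decision and chance nodes of a bi-agent influence diagram: a decision of one of the
agents, a chance node pertinent to one agent only, or a chance node shared by both agents. -/
inductive NodeKind where
  | decision (a : Agent)
  | privateChance (a : Agent)
  | sharedChance

/-- The node is a chance node of the original graph that is pertinent to agent `a`. -/
def NodeKind.isOwnChance : NodeKind → Agent → Bool
  | .privateChance .defender, .defender => true
  | .privateChance .attacker, .attacker => true
  | .sharedChance, _ => true
  | _, _ => false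

/-- The node is an uncertainty for agent `a`: a chance node pertinent to `a`, or a decision of the
opponent. -/
def NodeKind.isChanceFor : NodeKind → Agent → Bool
  | .decision .attacker, .defender => true
  | .decision .defender, .attacker => true
  | k, a => k.isOwnChance a

/-- The node belongs to the influence diagram of agent `a`: all decisions do, and so do the chance
nodes pertinent to `a`. -/
def NodeKind.inDiagram : NodeKind → Agent → Bool
  | .decision _, _ => true
  | k, a => k.isOwnChance a

section Ingredients

variable {V : Type*} {X : V → Type*} [∀ v, MeasurableSpace (X v)]

/-- A conditional probability distribution `p(x_v | x_S)`, given by a density with respect to the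
reference measure `ν` (Lebesgue measure or counting measure, typically). -/
structure CondDensity (S : Finset V) (v : V) (ν : Measure (X v)) where
  dens : (∀ w : S, X w) → X v → ℝ≥0
  measurable_dens : Measurable fun z : (∀ w : S, X w) × X v => dens z.1 z.2
  lintegral_dens : ∀ c, ∫⁻ a, (dens c a : ℝ≥0∞) ∂ν = 1

/-- The value of a conditional density at a full configuration. -/
def CondDensity.eval {S : Finset V} {v : V} {ν : Measure (X v)} (p : CondDensity S v ν)
    (x : ∀ v, X v) : ℝ≥0∞ :=
  (p.dens (S.restrict x) (x v) : ℝ≥0∞)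

/-- A random conditional probability distribution `P^ω(x_v | x_S)`. -/
structure RandDensity (Ω : Type*) [MeasurableSpace Ω] (S : Finset V) (v : V)
    (ν : Measure (X v)) where
  dens : Ω → (∀ w : S, X w) → X v → ℝ≥0
  measurable_dens : Measurable fun z : Ω × (∀ w : S, X w) × X v => dens z.1 z.2.1 z.2.2
  lintegral_dens : ∀ ω c, ∫⁻ a, (dens ω c a : ℝ≥0∞) ∂ν = 1

/-- The value of a random conditional density at a full configuration, for the outcome `ω`. -/
def RandDensity.eval {Ω : Type*} [MeasurableSpace Ω] {S : Finset V} {v : V} {ν : Measure (X v)}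
    (p : RandDensity Ω S v ν) (ω : Ω) (x : ∀ v, X v) : ℝ≥0∞ :=
  (p.dens ω (S.restrict x) (x v) : ℝ≥0∞)

/-- A decision rule at node `v` when the values of the nodes in `S` are known. -/
structure Rule (X : V → Type*) [∀ v, MeasurableSpace (X v)] (S : Finset V) (v : V) where
  act : (∀ w : S, X w) → X v
  measurable_act : Measurable act

/-- A random decision rule at node `v` when the values of the nodes in `S` are known. -/
structure RandRule (X : V → Type*) [∀ v, MeasurableSpace (X v)] (Ω : Type*) [MeasurableSpace Ω]
    (S : Finset V) (v : V) where
  act : Ω → (∀ w : S, X w) → X v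
  measurable_act : Measurable fun z : Ω × (∀ w : S, X w) => act z.1 z.2

/-- The rule obtained for the outcome `ω`. -/
def RandRule.at {Ω : Type*} [MeasurableSpace Ω] {S : Finset V} {v : V} (r : RandRule X Ω S v)
    (ω : Ω) : Rule X S v where
  act := r.act ω
  measurable_act := r.measurable_act.comp measurable_prodMk_left

end Ingredients

/-- A bi-agent influence diagram (BAID), with the Defender's utility and probabilities and her
random utility and random probabilities for the Attacker. `V` is the set of decision and chance
nodes, `X v` the set of values (alternatives or outcomes) of the node `v`, and `Ω` carries the
common probability space of the random ingredients. The two utility nodes have no successors, so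
they are recorded through their antecessors `uPa`. -/
structure BAID (V : Type*) [Fintype V] [DecidableEq V] (X : V → Type*)
    [∀ v, MeasurableSpace (X v)] (Ω : Type*) [MeasurableSpace Ω] where
  kind : V → NodeKind
  /-- the (direct) antecessors of a node; those of a decision node are known when deciding -/
  pa : V → Finset V
  /-- the antecessors of the utility node of each agent -/
  uPa : Agent → Finset V
  /-- reference measures, with respect to which the densities are taken -/
  ν : ∀ v, Measure (X v)
  sigmaFinite_ν : ∀ v, SigmaFinite (ν v)
  ν_ne_zero : ∀ v, ν v ≠ 0
  /-- the Defender's utility `u_D` -/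
  uD : (∀ w : uPa .defender, X w) → ℝ
  measurable_uD : Measurable uD
  uD_pos : ∀ c, 0 < uD c
  /-- the Defender's probabilities `p_D(x | ant(x))` at the chance nodes. None is given for the
  Attacker's decisions. -/
  pD : ∀ v, (kind v).isOwnChance .defender = true → CondDensity (pa v) v (ν v)
  /-- the probability on `Ω` -/
  P : Measure Ω
  isProbabilityMeasure_P : IsProbabilityMeasure P
  /-- the Attacker's random utility `U_A` -/
  UA : Ω → (∀ w : uPa .attacker, X w) → ℝ
  measurable_UA : Measurable fun z : Ω × (∀ w : uPa .attacker, X w) => UA z.1 z.2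
  UA_pos : ∀ᵐ ω ∂P, ∀ c, 0 < UA ω c
  /-- the Attacker's random probabilities `P_A(x | ant(x))` at his chance nodes, and his initial
  random beliefs `P_A(d | ant(d))` about the Defender's decisions -/
  PA : ∀ v, (kind v).isChanceFor .attacker = true → RandDensity Ω (pa v) v (ν v)
  /-- the reassessed beliefs `P_A(d | ant(d))` about the Defender's decision `d`, once her optimal
  decision rule there has been found -/
  reassess : ∀ v, kind v = .decision .defender → Rule X (pa v) v →
    RandDensity Ω (pa v) v (ν v)

namespace BAID

variable {V : Type*} [Fintype V] [DecidableEq V] {X : V → Type*} [∀ v, MeasurableSpace (X v)]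
  {Ω : Type*} [MeasurableSpace Ω]

/-! ### Proper diagrams -/

/-- Existence of a directed path (with at least one arc) from `a` to `b`. -/
def Precedes (B : BAID V X Ω) (a b : V) : Prop :=
  Relation.TransGen (fun u v => u ∈ B.pa v) a b

/-- `l` lists the decision nodes of agent `a` along a directed path which contains all of them and
leads to the utility node of `a`: the DDP for the Defender and the ADP for the Attacker. -/
structure IsDecisionPath (B : BAID V X Ω) (a : Agent) (l : List V) : Prop where
  nodup : l.Nodup
  mem_iff : ∀ v, v ∈ l ↔ B.kind v = .decision a
  chain : l.IsChain B.Precedes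
  utility : ∀ v ∈ l.getLast?, ∃ w ∈ B.uPa a, v = w ∨ B.Precedes v w

/-- The influence diagram of agent `a` is proper: all its nodes have their antecessors in it, there
is a directed path through the decisions of `a` to the utility node of `a`, and `a` does not forget:
an earlier decision and what was known when taking it are known at all later decisions of `a`. -/
structure ProperFor (B : BAID V X Ω) (a : Agent) : Prop where
  pa_mem : ∀ v, (B.kind v).inDiagram a = true → ∀ w ∈ B.pa v, (B.kind w).inDiagram a = true
  uPa_mem : ∀ w ∈ B.uPa a, (B.kind w).inDiagram a = true
  path : ∃ l, B.IsDecisionPath a l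
  no_forgetting : ∀ v w, B.kind v = .decision a → B.kind w = .decision a → B.Precedes v w →
    insert v (B.pa v) ⊆ B.pa w

/-- A proper BAID: acyclic, and proper from the perspective of each agent. -/
structure Proper (B : BAID V X Ω) : Prop where
  acyclic : ∀ v, ¬ B.Precedes v v
  proper : ∀ a, B.ProperFor a

/-! ### Policies and expected utilities -/

/-- The nodes that are uncertainties for agent `a`. -/
def chanceNodes (B : BAID V X Ω) (a : Agent) : Finset V :=
  Finset.univ.filter fun v => (B.kind v).isChanceFor a = true

/-- A policy: a decision rule at each node, depending on what is known there. Only the rules at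
the decision nodes of the agent under consideration matter. -/
abbrev Policy (B : BAID V X Ω) := ∀ v, Rule X (B.pa v) v

/-- The Defender's utility, as a function of the full configuration. -/
def utilD (B : BAID V X Ω) (x : ∀ v, X v) : ℝ≥0∞ :=
  ENNReal.ofReal (B.uD ((B.uPa .defender).restrict x))

/-- The Attacker's random utility, as a function of the full configuration. -/
def utilA (B : BAID V X Ω) (ω : Ω) (x : ∀ v, X v) : ℝ≥0∞ :=
  ENNReal.ofReal (B.UA ω ((B.uPa .attacker).restrict x))

/-- The Defender's probabilities that are available so far (`none`: not available). -/
abbrev DefProbs (B : BAID V X Ω) := ∀ v, Option (CondDensity (B.pa v) v (B.ν v))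

/-- The Attacker's random probabilities (`none`: there is none, as at his own decisions). -/
abbrev AttProbs (B : BAID V X Ω) := ∀ v, Option (RandDensity Ω (B.pa v) v (B.ν v))

/-- Evaluation of the probabilities at a configuration; the value for `none` plays no role. -/
def evalD (B : BAID V X Ω) (p : B.DefProbs) (v : V) (x : ∀ v, X v) : ℝ≥0∞ :=
  (p v).elim 0 fun q => q.eval x

/-- Evaluation of the random probabilities; the value for `none` plays no role. -/
def evalA (B : BAID V X Ω) (p : B.AttProbs) (ω : Ω) (v : V) (x : ∀ v, X v) : ℝ≥0∞ :=
  (p v).elim 0 fun q => q.eval ω x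

/-- The configuration in which the decisions along `path` are those prescribed, one after the other,
by the policy `δ`, and the other nodes have the values given by `x`. -/
def play (B : BAID V X Ω) (path : List V) (δ : B.Policy) (x : ∀ v, X v) : ∀ v, X v :=
  path.foldl (fun x v => Function.update x v ((δ v).act ((B.pa v).restrict x))) x

/-- The expected utility of the policy `δ` in an influence diagram with decision path `path`,
uncertain nodes `C`, their conditional densities `p` and utility `u`: the integral of `u` times the
joint density over the values of the nodes in `C`. The values of `x₀` at the nodes of `C` and of
`path` are irrelevant. -/
def expectedUtility (B : BAID V X Ω) (path : List V) (C : Finset V) (u : (∀ v, X v) → ℝ≥0∞)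
    (p : V → (∀ v, X v) → ℝ≥0∞) (δ : B.Policy) (x₀ : ∀ v, X v) : ℝ≥0∞ :=
  lmarginal B.ν C (fun x => u (B.play path δ x) * ∏ k ∈ C, p k (B.play path δ x)) x₀

/-- The Defender's expected utility, for the probabilities `p`. -/
def euD (B : BAID V X Ω) (ddp : List V) (p : B.DefProbs) (δ : B.Policy) (x₀ : ∀ v, X v) : ℝ≥0∞ :=
  B.expectedUtility ddp (B.chanceNodes .defender) B.utilD (B.evalD p) δ x₀

/-- The Attacker's random expected utility, for the random probabilities `p`. -/
def euA (B : BAID V X Ω) (adp : List V) (p : B.AttProbs) (ω : Ω) (δ : B.Policy)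
    (x₀ : ∀ v, X v) : ℝ≥0∞ :=
  B.expectedUtility adp (B.chanceNodes .attacker) (B.utilA ω) (B.evalA p ω) δ x₀

/-! ### APS reductions -/

/-- A node together with its antecessors: the variables in its conditional distribution. -/
def family (B : BAID V X Ω) (v : V) : Finset V := insert v (B.pa v)

/-- A partially reduced influence diagram of one agent. `chance` are the remaining uncertain nodes,
`factors` those nodes whose (original) conditional distribution has not been absorbed into the value
function yet, and `valuePa` the current antecessors of the value node. -/
structure Diagram (V : Type*) where
  chance : Finset V
  factors : Finset V
  valuePa : Finset V

/-- The chance nodes to be eliminated before the decision node `D`, by chance node removals and arc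
inversions. A chance node that is not known at `D` has to be eliminated before `D` if it is an
antecessor of the value node, or appears together with `D` in a conditional distribution. Inverting
the arcs out of such a node `u` and then removing it turns the antecessors of `u`, the successors of
`u` and the antecessors of these successors, i.e. the nodes that appear together with `u` in a
conditional distribution, into antecessors of the value node; those which are not known at `D` have
to be eliminated before `D` too. -/
inductive EliminatedBefore (B : BAID V X Ω) (G : Diagram V) (D : V) : V → Prop
  | value (v : V) (hv : v ∈ G.chance) (hobs : v ∉ B.pa D) (hval : v ∈ G.valuePa) :
      EliminatedBefore B G D v
  | decision (v k : V) (hv : v ∈ G.chance) (hobs : v ∉ B.pa D) (hk : k ∈ G.factors)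
      (hD : D ∈ B.family k) (hvk : v ∈ B.family k) : EliminatedBefore B G D v
  | link (u v k : V) (hu : EliminatedBefore B G D u) (hv : v ∈ G.chance) (hobs : v ∉ B.pa D)
      (hk : k ∈ G.factors) (huk : u ∈ B.family k) (hvk : v ∈ B.family k) :
      EliminatedBefore B G D v

open Classical in
/-- The set `X_c(D)` of chance nodes to be eliminated before `D`. -/
def Xc (B : BAID V X Ω) (G : Diagram V) (D : V) : Finset V :=
  Finset.univ.filter fun v => B.EliminatedBefore G D v

/-- The nodes whose conditional distributions enter the augmented distribution for `D`: those, not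
used before, in which `D` or a node of `X_c(D)` appears. -/
def usedFactors (B : BAID V X Ω) (G : Diagram V) (D : V) : Finset V :=
  G.factors.filter fun k => ¬ Disjoint (B.family k) (insert D (B.Xc G D))

/-- The diagram after elimination of `D` and `X_c(D)`: the value node inherits the antecessors which
are not eliminated. -/
def reduceDiagram (B : BAID V X Ω) (G : Diagram V) (D : V) : Diagram V where
  chance := G.chance \ B.Xc G D
  factors := G.factors \ B.usedFactors G D
  valuePa := (G.valuePa ∪ (B.usedFactors G D).biUnion B.family) \ insert D (B.Xc G D)

/-- Current value function times the conditional densities involved. -/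
def augWeight (B : BAID V X Ω) (G : Diagram V) (D : V) (ψ : (∀ v, X v) → ℝ≥0∞)
    (p : V → (∀ v, X v) → ℝ≥0∞) (x : ∀ v, X v) : ℝ≥0∞ :=
  ψ x * ∏ k ∈ B.usedFactors G D, p k x

/-- The augmented distribution `π(d, x_c | ·) ∝ ψ · ∏ p`, over the values of `D` and of `X_c(D)`
given those of the other nodes, normalised whenever this is possible. -/
def augDensity (B : BAID V X Ω) (G : Diagram V) (D : V) (ψ : (∀ v, X v) → ℝ≥0∞)
    (p : V → (∀ v, X v) → ℝ≥0∞) (x : ∀ v, X v) : ℝ≥0∞ :=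
  let Z := lmarginal B.ν (insert D (B.Xc G D)) (B.augWeight G D ψ p) x
  if Z = 0 ∨ Z = ∞ then B.augWeight G D ψ p x else B.augWeight G D ψ p x / Z

/-- `f` gives, for all values of the conditioning variables, a mode of the marginal in `D` of the
augmented distribution. -/
def IsModeRule (B : BAID V X Ω) (G : Diagram V) (D : V) (ψ : (∀ v, X v) → ℝ≥0∞)
    (p : V → (∀ v, X v) → ℝ≥0∞) (f : (∀ w : B.pa D, X w) → X D) : Prop :=
  ∀ (x : ∀ v, X v) (d : X D),
    lmarginal B.ν (B.Xc G D) (B.augDensity G D ψ p) (Function.update x D d) ≤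
      lmarginal B.ν (B.Xc G D) (B.augDensity G D ψ p)
        (Function.update x D (f ((B.pa D).restrict x)))

/-- The value function to be stored after the reduction, when the decision rule at `D` is `f`. -/
def reduceValue (B : BAID V X Ω) (G : Diagram V) (D : V) (ψ : (∀ v, X v) → ℝ≥0∞)
    (p : V → (∀ v, X v) → ℝ≥0∞) (f : (∀ w : B.pa D, X w) → X D) (x : ∀ v, X v) : ℝ≥0∞ :=
  lmarginal B.ν (B.Xc G D) (B.augWeight G D ψ p) (Function.update x D (f ((B.pa D).restrict x)))

/-! ### The algorithm -/

/-- A state of the algorithm. -/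
structure State (B : BAID V X Ω) where
  /-- what is left of the two decision paths -/
  ddp : List V
  adp : List V
  /-- the two partially reduced influence diagrams, with their value functions -/
  diagD : Diagram V
  diagA : Diagram V
  ψD : (∀ v, X v) → ℝ≥0∞
  ψA : Ω → (∀ v, X v) → ℝ≥0∞
  /-- the Defender's current probabilities and the Attacker's current random probabilities -/
  pD : B.DefProbs
  pA : B.AttProbs
  /-- the optimal decisions `d^*` and random optimal decisions `A^*` stored so far -/
  dStar : ∀ v, Option (Rule X (B.pa v) v)
  aStar : ∀ v, Option (RandRule X Ω (B.pa v) v)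

/-- The unreduced influence diagram of agent `a`. -/
def initDiagram (B : BAID V X Ω) (a : Agent) : Diagram V where
  chance := B.chanceNodes a
  factors := B.chanceNodes a
  valuePa := B.uPa a

/-- The initial state, for given decision paths. -/
def initState (B : BAID V X Ω) (ddp adp : List V) : B.State where
  ddp := ddp
  adp := adp
  diagD := B.initDiagram .defender
  diagA := B.initDiagram .attacker
  ψD := B.utilD
  ψA := B.utilA
  pD v := if h : (B.kind v).isOwnChance .defender = true then some (B.pD v h) else none
  pA v := if h : (B.kind v).isChanceFor .attacker = true then some (B.PA v h) else none
  dStar _ := none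
  aStar _ := none

/-- All `p_D` needed for the Defender APS reduction of `D` are available. -/
def Available (B : BAID V X Ω) (s : B.State) (D : V) : Prop :=
  ∀ k ∈ B.usedFactors s.diagD D, (s.pD k).isSome

/-- `r` is a decision rule that the Defender APS reduction of `D` may return. -/
def DapsSolution (B : BAID V X Ω) (s : B.State) (D : V) (r : Rule X (B.pa D) D) : Prop :=
  B.IsModeRule s.diagD D s.ψD (B.evalD s.pD) r.act

/-- `r` is a random decision rule that the Attacker APS reduction of `A` may return. -/
def AapsSolution (B : BAID V X Ω) (s : B.State) (A : V) (r : RandRule X Ω (B.pa A) A) : Prop :=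
  ∀ᵐ ω ∂B.P, B.IsModeRule s.diagA A (s.ψA ω) (B.evalA s.pA ω) (r.act ω)

/-- `q` is the Defender's distribution `p_D(a | ·)` over the Attacker's decision at `A`: the density
of the distribution of the random decision `A^*(·)`. -/
def IsForecast (B : BAID V X Ω) (A : V) (r : RandRule X Ω (B.pa A) A)
    (q : CondDensity (B.pa A) A (B.ν A)) : Prop :=
  ∀ c, B.P.map (fun ω => r.act ω c) = (B.ν A).withDensity fun a => (q.dens c a : ℝ≥0∞)

/-- The Attacker's beliefs about `D` after the Defender's decision rule at `D` has been found. They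
are reassessed if they have not been used yet in the Attacker's diagram. -/
def updateBeliefs (B : BAID V X Ω) (s : B.State) (D : V) (hD : B.kind D = .decision .defender)
    (r : Rule X (B.pa D) D) : B.AttProbs :=
  if D ∈ s.diagA.factors then Function.update s.pA D (some (B.reassess D hD r)) else s.pA

/-- An iteration of the loop with a Defender APS reduction of the last decision node in the DDP. -/
inductive DapsStep (B : BAID V X Ω) : B.State → B.State → Prop
  | mk (s : B.State) (l : List V) (D : V) (hl : s.ddp = l ++ [D])
      (hD : B.kind D = .decision .defender) (hav : B.Available s D)
      (r : Rule X (B.pa D) D) (hr : B.DapsSolution s D r) :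
      DapsStep B s
        { s with
          ddp := l
          diagD := B.reduceDiagram s.diagD D
          ψD := B.reduceValue s.diagD D s.ψD (B.evalD s.pD) r.act
          pA := B.updateBeliefs s D hD r
          dStar := Function.update s.dStar D (some r) }

/-- An iteration of the loop with an Attacker APS reduction of the last decision node in the ADP. -/
inductive AapsStep (B : BAID V X Ω) : B.State → B.State → Prop
  | mk (s : B.State) (l l' : List V) (D A : V) (hl : s.ddp = l ++ [D])
      (hav : ¬ B.Available s D) (hl' : s.adp = l' ++ [A])
      (r : RandRule X Ω (B.pa A) A) (hr : B.AapsSolution s A r)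
      (q : CondDensity (B.pa A) A (B.ν A)) (hq : B.IsForecast A r q) :
      AapsStep B s
        { s with
          adp := l'
          diagA := B.reduceDiagram s.diagA A
          ψA := fun ω => B.reduceValue s.diagA A (s.ψA ω) (B.evalA s.pA ω) (r.act ω)
          pD := Function.update s.pD A (some q)
          aStar := Function.update s.aStar A (some r) }

/-- `B.Run i j s t`: starting in `s`, the algorithm may reach `t` with `i` Defender APS reductions
and `j` Attacker APS reductions. -/
inductive Run (B : BAID V X Ω) : ℕ → ℕ → B.State → B.State → Prop
  | refl (s : B.State) : Run B 0 0 s s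
  | daps {i j : ℕ} {s t t' : B.State} (h : Run B i j s t) (hs : B.DapsStep t t') :
      Run B (i + 1) j s t'
  | aaps {i j : ℕ} {s t t' : B.State} (h : Run B i j s t) (hs : B.AapsStep t t') :
      Run B i (j + 1) s t'

/-- The reduction that is due in state `s` has a solution: the maximum is attained by a (random)
decision rule, which for the Attacker has a conditional density. -/
def Solvable (B : BAID V X Ω) (s : B.State) : Prop :=
  ∀ l D, s.ddp = l ++ [D] →
    (B.Available s D → ∃ r, B.DapsSolution s D r) ∧
    (¬ B.Available s D → ∀ l' A, s.adp = l' ++ [A] →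
      ∃ r q, B.AapsSolution s A r ∧ B.IsForecast A r q)

/-- All decision sets are finite (and each alternative has positive reference measure). -/
def FiniteDecisions (B : BAID V X Ω) : Prop :=
  ∀ v a, B.kind v = .decision a →
    Finite (X v) ∧ MeasurableSingletonClass (X v) ∧ ∀ x, B.ν v {x} ≠ 0

/-! ### Optimality -/

/-- `p` consists of the probabilities `s.pD` and of arbitrary ones at the nodes that are uncertain
for the Defender and for which `s.pD` contains none. -/
def IsCompletion (B : BAID V X Ω) (s : B.State) (p : B.DefProbs) : Prop :=
  (∀ v q, s.pD v = some q → p v = some q) ∧ ∀ v ∈ B.chanceNodes .defender, (p v).isSome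

/-- The policy `δ` with the rules at the nodes of `l` replaced by those of `δ'`. -/
def replaceOn (B : BAID V X Ω) (l : List V) (δ δ' : B.Policy) : B.Policy :=
  fun v => if v ∈ l then δ' v else δ v

/-- The policy `δ` with the rules replaced by the stored optimal ones `A^{*ω}` where there are
any. -/
def replaceStored (B : BAID V X Ω) (s : B.State) (ω : Ω) (δ : B.Policy) : B.Policy :=
  fun v => (s.aStar v).elim (δ v) fun r => r.at ω

/-- The output of the algorithm in the final state `s` is the solution of the game from the ARA
perspective. -/
structure IsOptimalOutput (B : BAID V X Ω) (ddp adp : List V) (s : B.State) : Prop where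
  /-- A forecast at an Attacker's decision is the distribution of a random decision rule. -/
  forecast : ∀ v q, B.kind v = .decision .attacker → s.pD v = some q →
    ∃ r, s.aStar v = some r ∧ B.IsForecast v r q
  /-- Each stored random decision rule has its forecast. -/
  stored : ∀ v r, s.aStar v = some r → B.kind v = .decision .attacker ∧
    ∃ q, s.pD v = some q ∧ B.IsForecast v r q
  /-- At the other chance nodes, the probabilities are the Defender's original ones. -/
  original : ∀ v (h : (B.kind v).isOwnChance .defender = true), s.pD v = some (B.pD v h)
  /-- The Attacker's random probabilities are the original ones, or the reassessed ones at some
  of the Defender's decisions. -/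
  beliefs : ∀ v (h : (B.kind v).isChanceFor .attacker = true), s.pA v = some (B.PA v h) ∨
    ∃ (hv : B.kind v = .decision .defender) (r : Rule X (B.pa v) v), s.dStar v = some r ∧
      s.pA v = some (B.reassess v hv r)
  /-- The random decision rules are almost surely optimal for the Attacker, whatever he does at
  those (earlier) decisions of which no forecast was needed. -/
  attacker : ∀ᵐ ω ∂B.P, ∀ (σ : B.Policy) (x₀ : ∀ v, X v),
    B.euA adp s.pA ω σ x₀ ≤ B.euA adp s.pA ω (B.replaceStored s ω σ) x₀
  /-- The stored rules form an optimal policy of the Defender, whatever the distributions at those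
  decisions of the Attacker of which no forecast was needed; moreover, from any stage on, they
  are optimal after any rules at the earlier stages. -/
  defender : ∃ δ : B.Policy, (∀ v ∈ ddp, s.dStar v = some (δ v)) ∧
    ∀ p : B.DefProbs, B.IsCompletion s p → ∀ (δ' : B.Policy) (x₀ : ∀ v, X v),
      B.euD ddp p δ' x₀ ≤ B.euD ddp p δ x₀ ∧
      ∀ l l', ddp = l ++ l' → B.euD ddp p δ' x₀ ≤ B.euD ddp p (B.replaceOn l' δ' δ) x₀

end BAID

end

/-! The argument is backward induction, run in two diagrams at once. All integrands take values in
[0,∞], so Tonelli allows the nodes of X_c(D) to be integrated first. By no forgetting none of them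
is known at D or at an earlier decision, so the play does not react to them (`play_updateFinset`);
the unused distributions involve neither D nor X_c(D) and leave the integral. What remains is the
marginal of the augmented weight at the action chosen at D (`reducedUtility_append`). The
normalising constant does not depend on that action, so a mode maximises this marginal pointwise
(`isModeRule_iff`). Hence a reduction bounds the expected utility of every policy, with equality for
those that follow the stored rule.

The diagrams interact through probabilities that change during a run. `IsReduction` therefore
asserts its bounds for every family `q` that agrees with the current probabilities at the
distributions already used. A reassessment alters only a distribution which the Attacker's diagram
has not used; a forecast appears only where the Defender had no density, hence at a node she has not
used. So each step reduces one diagram and does no harm to the other (`Invariant.daps`,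
`Invariant.aaps`). The same freedom in `q` covers arbitrary densities at the Attacker decisions that
were never reduced.

A density that is needed but missing can only belong to an Attacker decision still in the ADP
(`Invariant.adp_ne_nil`). For finite decision sets a maximiser can be selected measurably, because
the marginal depends only on what is known at the decision, and the random maximiser at A has
density P(A* = a)/ν{a}. -/

noncomputable section

/-! ### Scopes and joint measurability of marginals; measurable selection -/

section Marginals

variable {V : Type*} [DecidableEq V] {X : V → Type*} [∀ v, MeasurableSpace (X v)]

theorem DependsOn.lmarginal {μ : ∀ v, Measure (X v)} {S : Finset V} {T : Set V}
    {f : (∀ v, X v) → ℝ≥0∞} (hf : DependsOn f T) :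
    DependsOn (lmarginal μ S f) (T \ S) := by
  intro x y h
  refine lintegral_congr fun z => hf fun v hv => ?_
  by_cases hS : v ∈ S
  · simp [Function.updateFinset, hS]
  · simpa [Function.updateFinset, hS] using h v ⟨hv, by simpa using hS⟩

theorem DependsOn.comp_update {V : Type*} [DecidableEq V] {X : V → Type*} {α : Type*} {T : Set V} {f : (∀ v, X v) → α} (hf : DependsOn f T)
    (D : V) (d : X D) : DependsOn (fun x => f (Function.update x D d)) (T \ {D}) := by
  intro x y h
  refine hf fun v hv => ?_
  by_cases hD : v = D
  · subst hD; simp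
  · simpa [hD] using h v ⟨hv, hD⟩

/-- Needed jointly in the outcome and the configuration, since the Attacker's rules must be jointly
measurable. -/
theorem measurable_lmarginal_param {Ω : Type*} [MeasurableSpace Ω] {μ : ∀ v, Measure (X v)}
    [∀ v, SigmaFinite (μ v)] {S : Finset V} {f : Ω → (∀ v, X v) → ℝ≥0∞}
    (hf : Measurable fun z : Ω × (∀ v, X v) => f z.1 z.2) :
    Measurable fun z : Ω × (∀ v, X v) => lmarginal μ S (f z.1) z.2 := by
  unfold MeasureTheory.lmarginal
  refine Measurable.lintegral_prod_right
    (f := fun (w : Ω × (∀ v, X v)) (y : ∀ v : S, X v) =>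
      f w.1 (Function.updateFinset w.2 S y)) ?_
  exact hf.comp (measurable_fst.fst.prodMk
    (measurable_updateFinset'.comp (measurable_fst.snd.prodMk measurable_snd)))

theorem measurable_update_param {α : Type*} [MeasurableSpace α] {D : V} {g : α → ∀ v, X v}
    (hg : Measurable g) {e : α → X D} (he : Measurable e) :
    Measurable fun z => Function.update (g z) D (e z) := by
  refine measurable_pi_lambda _ fun v => ?_
  by_cases hD : v = D
  · subst hD; simpa using he
  · simpa [hD] using measurable_pi_iff.1 hg v

/-- A measurable selection of a maximiser over a finite set. -/
theorem exists_measurable_argmax {Z α : Type*} [MeasurableSpace Z] [MeasurableSpace α] [Finite α]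
    [Nonempty α] (g : α → Z → ℝ≥0∞) (hg : ∀ a, Measurable (g a)) :
    ∃ f : Z → α, Measurable f ∧ ∀ z a, g a z ≤ g (f z) z := by
  classical
  cases nonempty_fintype α
  -- Induction over the candidates. Measurability of the attained value is carried along, because
  -- the set where the next candidate wins is defined by comparison with it.
  have key : ∀ s : Finset α, ∃ f : Z → α, Measurable f ∧ (Measurable fun z => g (f z) z) ∧
      ∀ z, ∀ a ∈ s, g a z ≤ g (f z) z := by
    intro s
    induction s using Finset.induction_on with
    | empty =>
      exact ⟨fun _ => Classical.arbitrary α, measurable_const, hg _, by simp⟩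
    | insert b s hb ih =>
      obtain ⟨f, hf, hgf, hmax⟩ := ih
      have hset : MeasurableSet {z | g (f z) z ≤ g b z} := measurableSet_le hgf (hg b)
      refine ⟨fun z => if g (f z) z ≤ g b z then b else f z,
        Measurable.ite hset measurable_const hf, ?_, ?_⟩
      · have h : (fun z => g (if g (f z) z ≤ g b z then b else f z) z) =
            fun z => if g (f z) z ≤ g b z then g b z else g (f z) z := by
          funext z
          split_ifs <;> rfl
        rw [h]
        exact Measurable.ite hset (hg b) hgf
      · intro z a ha
        dsimp only
        rcases Finset.mem_insert.1 ha with rfl | ha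
        · split_ifs with h
          · exact le_rfl
          · exact (not_le.1 h).le
        · split_ifs with h
          · exact (hmax z a ha).trans h
          · exact hmax z a ha
  obtain ⟨f, hf, -, hmax⟩ := key Finset.univ
  exact ⟨f, hf, fun z a => hmax z a (Finset.mem_univ a)⟩

end Marginals

namespace BAID

variable {V : Type*} [Fintype V] [DecidableEq V] {X : V → Type*} [∀ v, MeasurableSpace (X v)]
  {Ω : Type*} [MeasurableSpace Ω]

instance (B : BAID V X Ω) (v : V) : SigmaFinite (B.ν v) := B.sigmaFinite_ν v

instance (B : BAID V X Ω) : IsProbabilityMeasure B.P := B.isProbabilityMeasure_P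

theorem nonempty_value (B : BAID V X Ω) (v : V) : Nonempty (X v) :=
  have : NeZero (B.ν v) := ⟨B.ν_ne_zero v⟩
  (B.ν v).nonempty_of_neZero

/-! ### Measurability and scopes of the ingredients -/

theorem measurable_utilD (B : BAID V X Ω) : Measurable B.utilD :=
  (B.measurable_uD.comp (Finset.measurable_restrict _)).ennreal_ofReal

theorem dependsOn_utilD (B : BAID V X Ω) : DependsOn B.utilD (B.uPa .defender : Set V) := by
  intro x y h
  unfold utilD
  rw [show (B.uPa .defender).restrict x = (B.uPa .defender).restrict y from
    funext fun v => h v v.2]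

theorem measurable_utilA (B : BAID V X Ω) :
    Measurable fun z : Ω × (∀ v, X v) => B.utilA z.1 z.2 :=
  (B.measurable_UA.comp (measurable_fst.prodMk
    ((Finset.measurable_restrict _).comp measurable_snd))).ennreal_ofReal

theorem dependsOn_utilA (B : BAID V X Ω) (ω : Ω) :
    DependsOn (B.utilA ω) (B.uPa .attacker : Set V) := by
  intro x y h
  unfold utilA
  rw [show (B.uPa .attacker).restrict x = (B.uPa .attacker).restrict y from
    funext fun v => h v v.2]

theorem measurable_evalD (B : BAID V X Ω) (p : B.DefProbs) (v : V) :
    Measurable (B.evalD p v) := by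
  unfold evalD
  cases p v with
  | none => exact measurable_const
  | some q =>
    exact (q.measurable_dens.comp ((Finset.measurable_restrict _).prodMk
      (measurable_pi_apply v))).coe_nnreal_ennreal

theorem dependsOn_evalD (B : BAID V X Ω) (p : B.DefProbs) (v : V) :
    DependsOn (B.evalD p v) (B.family v : Set V) := by
  intro x y h
  unfold evalD
  cases p v with
  | none => rfl
  | some q =>
    have h1 : (B.pa v).restrict x = (B.pa v).restrict y :=
      funext fun w => h w (Finset.mem_insert_of_mem w.2)
    simp [CondDensity.eval, h1, h v (Finset.mem_insert_self _ _)]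

theorem measurable_evalA (B : BAID V X Ω) (p : B.AttProbs) (v : V) :
    Measurable fun z : Ω × (∀ v, X v) => B.evalA p z.1 v z.2 := by
  unfold evalA
  cases p v with
  | none => exact measurable_const
  | some q =>
    exact (q.measurable_dens.comp (measurable_fst.prodMk
      (((Finset.measurable_restrict _).comp measurable_snd).prodMk
      ((measurable_pi_apply v).comp measurable_snd)))).coe_nnreal_ennreal

theorem dependsOn_evalA (B : BAID V X Ω) (p : B.AttProbs) (ω : Ω) (v : V) :
    DependsOn (B.evalA p ω v) (B.family v : Set V) := by
  intro x y h
  unfold evalA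
  cases p v with
  | none => rfl
  | some q =>
    have h1 : (B.pa v).restrict x = (B.pa v).restrict y :=
      funext fun w => h w (Finset.mem_insert_of_mem w.2)
    simp [RandDensity.eval, h1, h v (Finset.mem_insert_self _ _)]

/-! ### Modes of the augmented distribution -/

/-- The normalising constant has `D` and X_c(D) integrated out, so changing these coordinates leaves
it fixed: one factor serves all `d`. Where normalisation is impossible the factor is 1. -/
theorem lmarginal_augDensity (B : BAID V X Ω) (G : Diagram V) (D : V) (ψ : (∀ v, X v) → ℝ≥0∞)
    (p : V → (∀ v, X v) → ℝ≥0∞) (x : ∀ v, X v) :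
    ∃ c : ℝ≥0∞, c ≠ 0 ∧ c ≠ ∞ ∧ ∀ d : X D,
      lmarginal B.ν (B.Xc G D) (B.augDensity G D ψ p) (Function.update x D d) =
        c * lmarginal B.ν (B.Xc G D) (B.augWeight G D ψ p) (Function.update x D d) := by
  set Z := lmarginal B.ν (insert D (B.Xc G D)) (B.augWeight G D ψ p) with hZ
  have hconst : ∀ (d : X D) z,
      Z (Function.updateFinset (Function.update x D d) (B.Xc G D) z) = Z x := by
    intro d z
    refine lmarginal_congr _ _ fun v hv => ?_
    simp only [Finset.mem_insert, not_or] at hv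
    simp [Function.updateFinset, hv.1, hv.2]
  by_cases h : Z x = 0 ∨ Z x = ∞
  · refine ⟨1, one_ne_zero, ENNReal.one_ne_top, fun d => ?_⟩
    rw [one_mul]
    refine lintegral_congr fun z => ?_
    simp only [augDensity]
    rw [← hZ, hconst, if_pos h]
  · have hc : (Z x)⁻¹ ≠ ∞ := by simpa using fun h0 => h (Or.inl h0)
    refine ⟨(Z x)⁻¹, by simpa using fun h0 => h (Or.inr h0), hc, fun d => ?_⟩
    unfold lmarginal
    rw [← lintegral_const_mul' _ _ hc]
    refine lintegral_congr fun z => ?_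
    simp only [augDensity]
    rw [← hZ, hconst, if_neg h, div_eq_mul_inv, mul_comm]

/-- A mode of the augmented distribution maximises the marginal of the unnormalised weight. -/
theorem isModeRule_iff (B : BAID V X Ω) (G : Diagram V) (D : V) (ψ : (∀ v, X v) → ℝ≥0∞)
    (p : V → (∀ v, X v) → ℝ≥0∞) (f : (∀ w : B.pa D, X w) → X D) :
    B.IsModeRule G D ψ p f ↔ ∀ (x : ∀ v, X v) (d : X D),
      lmarginal B.ν (B.Xc G D) (B.augWeight G D ψ p) (Function.update x D d) ≤
        B.reduceValue G D ψ p f x := by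
  refine forall_congr' fun x => ?_
  obtain ⟨c, hc0, hc, h⟩ := B.lmarginal_augDensity G D ψ p x
  refine forall_congr' fun d => ?_
  rw [h, h]
  exact ENNReal.mul_le_mul_iff_right hc0 hc

/-! ### Plays -/

theorem play_append_singleton (B : BAID V X Ω) (l : List V) (D : V) (δ : B.Policy)
    (x : ∀ v, X v) :
    B.play (l ++ [D]) δ x = Function.update (B.play l δ x) D
      ((δ D).act ((B.pa D).restrict (B.play l δ x))) := by
  simp [play]

theorem measurable_play (B : BAID V X Ω) (l : List V) (δ : B.Policy) :
    Measurable (B.play l δ) := by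
  induction l using List.reverseRecOn with
  | nil => exact measurable_id
  | append_singleton l D ih =>
    simp_rw [funext (B.play_append_singleton l D δ)]
    exact measurable_update_param ih
      ((δ D).measurable_act.comp ((Finset.measurable_restrict _).comp ih))

theorem play_congr (B : BAID V X Ω) {l : List V} {δ δ' : B.Policy} (h : ∀ v ∈ l, δ v = δ' v) :
    B.play l δ = B.play l δ' := by
  induction l using List.reverseRecOn with
  | nil => rfl
  | append_singleton l D ih =>
    funext x
    rw [play_append_singleton, play_append_singleton, ih fun v hv => h v (by simp [hv]),
      h D (by simp)]

/-- Nodes of `S` are neither decided nor observed along `l`, so the decisions do not react to them.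
This is what lets the integral over X_c(D) move inside. -/
theorem play_updateFinset (B : BAID V X Ω) {l : List V} {S : Finset V} (δ : B.Policy)
    (hl : ∀ v ∈ l, v ∉ S) (hpa : ∀ v ∈ l, ∀ w ∈ B.pa v, w ∉ S) (x : ∀ v, X v)
    (z : ∀ v : S, X v) :
    B.play l δ (Function.updateFinset x S z) = Function.updateFinset (B.play l δ x) S z := by
  induction l using List.reverseRecOn with
  | nil => rfl
  | append_singleton l D ih =>
    have hD : (B.pa D).restrict (Function.updateFinset (B.play l δ x) S z) =
        (B.pa D).restrict (B.play l δ x) :=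
      funext fun w => by simp [Function.updateFinset, hpa D (by simp) w w.2]
    rw [play_append_singleton, play_append_singleton,
      ih (fun v hv => hl v (by simp [hv])) fun v hv => hpa v (by simp [hv]), hD]
    funext v
    by_cases hv : v = D
    · subst hv; simp [Function.updateFinset, hl v (by simp)]
    · simp [Function.updateFinset, hv]

/-- The decision nodes `path` are ordered without forgetting, and none of them is in `C`. -/
structure PerfectRecall (B : BAID V X Ω) (path : List V) (C : Finset V) : Prop where
  nodup : path.Nodup
  notMem : ∀ v ∈ path, v ∉ C
  forall_subset : path.Pairwise fun v w => insert v (B.pa v) ⊆ B.pa w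
  irrefl : ∀ v, v ∉ B.pa v

/-- In the diagram `G`, with decision path `l` and value function `ψ`, all scopes consist of
remaining nodes. -/
structure Coherent (B : BAID V X Ω) (l : List V) (G : Diagram V) (ψ : (∀ v, X v) → ℝ≥0∞) :
    Prop where
  family_mem : ∀ k ∈ G.factors, ∀ v ∈ B.family k, v ∈ G.chance ∨ v ∈ l
  valuePa_mem : ∀ v ∈ G.valuePa, v ∈ G.chance ∨ v ∈ l
  measurable : Measurable ψ
  dependsOn : DependsOn ψ (G.valuePa : Set V)

/-- The expected utility of the policy `δ` in a partially reduced diagram. -/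
def reducedUtility (B : BAID V X Ω) (l : List V) (G : Diagram V) (ψ : (∀ v, X v) → ℝ≥0∞)
    (p : V → (∀ v, X v) → ℝ≥0∞) (δ : B.Policy) (x₀ : ∀ v, X v) : ℝ≥0∞ :=
  lmarginal B.ν G.chance (fun x => ψ (B.play l δ x) * ∏ k ∈ G.factors, p k (B.play l δ x)) x₀

theorem reducedUtility_congr (B : BAID V X Ω) {l : List V} (G : Diagram V)
    (ψ : (∀ v, X v) → ℝ≥0∞) (p : V → (∀ v, X v) → ℝ≥0∞) {δ δ' : B.Policy}
    (h : ∀ v ∈ l, δ v = δ' v) (x₀ : ∀ v, X v) :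
    B.reducedUtility l G ψ p δ x₀ = B.reducedUtility l G ψ p δ' x₀ := by
  simp only [reducedUtility, B.play_congr h]

/-! ### One APS reduction and its effect on the expected utility -/

section Step

variable {B : BAID V X Ω} {path l l' : List V} {C : Finset V} {G : Diagram V} {D : V}
  {ψ : (∀ v, X v) → ℝ≥0∞} {p q : V → (∀ v, X v) → ℝ≥0∞}

theorem mem_Xc {v : V} : v ∈ B.Xc G D ↔ B.EliminatedBefore G D v := by
  simp [Xc]

theorem Xc_subset_chance : B.Xc G D ⊆ G.chance := by
  intro v hv
  cases mem_Xc.1 hv <;> assumption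

theorem notMem_pa_of_mem_Xc {v : V} (h : v ∈ B.Xc G D) : v ∉ B.pa D := by
  cases mem_Xc.1 h <;> assumption

theorem usedFactors_subset : B.usedFactors G D ⊆ G.factors :=
  Finset.filter_subset _ _

theorem disjoint_family_of_notMem_usedFactors {k : V} (hk : k ∈ G.factors)
    (hk' : k ∉ B.usedFactors G D) : Disjoint (B.family k) (insert D (B.Xc G D)) := by
  by_contra h
  exact hk' (Finset.mem_filter.2 ⟨hk, h⟩)

theorem PerfectRecall.of_append (h : B.PerfectRecall (l ++ l') C) : B.PerfectRecall l C where
  nodup := h.nodup.of_append_left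
  notMem v hv := h.notMem v (by simp [hv])
  forall_subset := (List.pairwise_append.1 h.forall_subset).1
  irrefl := h.irrefl

theorem PerfectRecall.last_mem (h : B.PerfectRecall (l ++ [D]) C) {v w : V} (hv : v ∈ l)
    (hw : w ∈ insert v (B.pa v)) : w ∈ B.pa D :=
  (List.pairwise_append.1 h.forall_subset).2.2 v hv D (by simp) hw

/-- The variables of the augmented weight. -/
theorem Coherent.dependsOn_augWeight (hG : B.Coherent l G ψ)
    (hp : ∀ k, DependsOn (p k) (B.family k : Set V)) :
    DependsOn (B.augWeight G D ψ p)
      ((G.valuePa ∪ (B.usedFactors G D).biUnion B.family : Finset V) : Set V) := by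
  intro x y h
  unfold augWeight
  congr 1
  · exact hG.dependsOn fun v hv => h v (by simpa using Or.inl hv)
  · refine Finset.prod_congr rfl fun k hk => hp k fun v hv => h v ?_
    simp only [Finset.coe_union, Set.mem_union, Finset.mem_coe, Finset.mem_biUnion]
    exact Or.inr ⟨k, hk, hv⟩

theorem Coherent.measurable_augWeight (hG : B.Coherent l G ψ) (hp : ∀ k, Measurable (p k)) :
    Measurable (B.augWeight G D ψ p) :=
  hG.measurable.mul (Finset.measurable_prod _ fun k _ => hp k)

/-- The variables of the augmented weight are the decision, the eliminated nodes and nodes which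
are known at the decision. -/
theorem Coherent.scope_subset (hG : B.Coherent (l ++ [D]) G ψ)
    (hrec : B.PerfectRecall (l ++ [D]) C) {v : V}
    (hv : v ∈ G.valuePa ∪ (B.usedFactors G D).biUnion B.family) :
    v ∈ B.pa D ∨ v = D ∨ v ∈ B.Xc G D := by
  by_contra! hcon
  obtain ⟨hpa, hvD, hXc⟩ := hcon
  have hl : v ∉ l ++ [D] := by
    intro h
    rcases List.mem_append.1 h with h | h
    · exact hpa (hrec.last_mem h (Finset.mem_insert_self _ _))
    · exact hvD (by simpa using h)
  -- `v` is now neither known at `D` nor a decision, hence a remaining chance node, and the closure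
  -- rules defining X_c(D) capture it: through the value node, through `D`, or through a node
  -- already captured.
  apply hXc
  rcases Finset.mem_union.1 hv with hv | hv
  · exact mem_Xc.2 (.value v ((hG.valuePa_mem v hv).resolve_right hl) hpa hv)
  · obtain ⟨k, hk, hvk⟩ := Finset.mem_biUnion.1 hv
    obtain ⟨hkG, hmeet⟩ := Finset.mem_filter.1 hk
    have hchance := (hG.family_mem k hkG v hvk).resolve_right hl
    obtain ⟨u, huk, hu⟩ := Finset.not_disjoint_iff.1 hmeet
    rcases Finset.mem_insert.1 hu with rfl | hu
    · exact mem_Xc.2 (.decision v k hchance hpa hkG huk hvk)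
    · exact mem_Xc.2 (.link u v k (mem_Xc.1 hu) hchance hpa hkG huk hvk)

/-- Once X_c(D) is integrated out and the action fixed, only known nodes are left in the scope.
Hence a maximiser found for one extension of the known values serves all extensions. -/
theorem Coherent.dependsOn_marginal (hG : B.Coherent (l ++ [D]) G ψ)
    (hrec : B.PerfectRecall (l ++ [D]) C) (hp : ∀ k, DependsOn (p k) (B.family k : Set V))
    (d : X D) :
    DependsOn (fun x => lmarginal B.ν (B.Xc G D) (B.augWeight G D ψ p) (Function.update x D d))
      (B.pa D : Set V) := by
  refine (((hG.dependsOn_augWeight hp).lmarginal).comp_update D d).mono ?_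
  rintro v ⟨⟨hv, hXc⟩, hD⟩
  rcases hG.scope_subset hrec (Finset.mem_coe.1 hv) with h | h | h
  · exact h
  · exact absurd h hD
  · exact absurd h hXc

/-- The rule may read any node of `B.pa D`, including some that are not antecessors of the new value
node. Written as a supremum over actions, the value function no longer refers to the rule, and this
spurious dependence disappears. -/
theorem reduceValue_eq_iSup {f : (∀ w : B.pa D, X w) → X D} (hf : B.IsModeRule G D ψ p f) :
    B.reduceValue G D ψ p f = fun x => ⨆ d : X D,
      lmarginal B.ν (B.Xc G D) (B.augWeight G D ψ p) (Function.update x D d) := by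
  funext x
  exact le_antisymm
    (le_iSup (fun d => lmarginal B.ν (B.Xc G D) (B.augWeight G D ψ p) (Function.update x D d)) _)
    (iSup_le fun d => (B.isModeRule_iff G D ψ p f).1 hf x d)

/-- An APS reduction preserves coherence. -/
theorem Coherent.reduce (hG : B.Coherent (l ++ [D]) G ψ)
    (hp : ∀ k, DependsOn (p k) (B.family k : Set V)) (hpm : ∀ k, Measurable (p k))
    (r : Rule X (B.pa D) D) (hr : B.IsModeRule G D ψ p r.act) :
    B.Coherent l (B.reduceDiagram G D) (B.reduceValue G D ψ p r.act) where
  family_mem k hk v hv := by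
    obtain ⟨hk, hk'⟩ := Finset.mem_sdiff.1 hk
    have hdis := disjoint_family_of_notMem_usedFactors hk hk'
    have hv' : v ∉ insert D (B.Xc G D) := Finset.disjoint_left.1 hdis hv
    simp only [Finset.mem_insert, not_or] at hv'
    rcases hG.family_mem k hk v hv with h | h
    · exact Or.inl (Finset.mem_sdiff.2 ⟨h, hv'.2⟩)
    · simp only [List.mem_append, List.mem_singleton, hv'.1, or_false] at h
      exact Or.inr h
  valuePa_mem v hv := by
    obtain ⟨hv, hv'⟩ := Finset.mem_sdiff.1 hv
    simp only [Finset.mem_insert, not_or] at hv'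
    have h : v ∈ G.chance ∨ v ∈ l ++ [D] := by
      rcases Finset.mem_union.1 hv with hv | hv
      · exact hG.valuePa_mem v hv
      · obtain ⟨k, hk, hvk⟩ := Finset.mem_biUnion.1 hv
        exact hG.family_mem k (usedFactors_subset hk) v hvk
    rcases h with h | h
    · exact Or.inl (Finset.mem_sdiff.2 ⟨h, hv'.2⟩)
    · simp only [List.mem_append, List.mem_singleton, hv'.1, or_false] at h
      exact Or.inr h
  measurable := ((hG.measurable_augWeight hpm).lmarginal B.ν).comp
    (measurable_update_param measurable_id (r.measurable_act.comp (Finset.measurable_restrict _)))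
  dependsOn := by
    rw [reduceValue_eq_iSup hr]
    intro x y h
    refine iSup_congr fun d => ?_
    refine ((hG.dependsOn_augWeight hp).lmarginal.comp_update D d) fun v hv => h v ?_
    simp only [Set.mem_sdiff, Finset.mem_coe, Set.mem_singleton_iff] at hv
    simp only [reduceDiagram, Finset.coe_sdiff, Set.mem_sdiff, Finset.mem_coe, Finset.mem_insert,
      not_or]
    exact ⟨hv.1.1, hv.2, hv.1.2⟩

/-- Elimination of the nodes of `X_c(D)` from the expected utility. -/
theorem reducedUtility_append (hG : B.Coherent (l ++ [D]) G ψ)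
    (hrec : B.PerfectRecall (l ++ [D]) C) (hC : G.chance ⊆ C)
    (hq : ∀ k, DependsOn (q k) (B.family k : Set V)) (hqm : ∀ k, Measurable (q k))
    (σ : B.Policy) (x₀ : ∀ v, X v) :
    B.reducedUtility (l ++ [D]) G ψ q σ x₀ =
      lmarginal B.ν (G.chance \ B.Xc G D) (fun x =>
        B.reduceValue G D ψ q (σ D).act (B.play l σ x) *
          ∏ k ∈ G.factors \ B.usedFactors G D, q k (B.play l σ x)) x₀ := by
  have hm : Measurable fun x => ψ (B.play (l ++ [D]) σ x) *
      ∏ k ∈ G.factors, q k (B.play (l ++ [D]) σ x) :=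
    (hG.measurable.comp (B.measurable_play _ σ)).mul
      (Finset.measurable_prod _ fun k _ => (hqm k).comp (B.measurable_play _ σ))
  have hXc : ∀ v ∈ l ++ [D], v ∉ B.Xc G D := fun v hv h =>
    hrec.notMem v hv (hC (Xc_subset_chance h))
  -- Whatever was known at an earlier decision is known at `D`, so a node unknown at `D` was never
  -- observed.
  have hpa : ∀ v ∈ l ++ [D], ∀ w ∈ B.pa v, w ∉ B.Xc G D := by
    intro v hv w hw h
    refine notMem_pa_of_mem_Xc h ?_
    rcases List.mem_append.1 hv with hv | hv
    · exact hrec.last_mem hv (Finset.mem_insert_of_mem hw)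
    · rwa [List.mem_singleton.1 hv] at hw
  unfold reducedUtility
  conv_lhs => rw [← Finset.sdiff_union_of_subset (Xc_subset_chance (B := B) (G := G) (D := D))]
  -- Tonelli, with X_c(D) as the inner integral.
  rw [lmarginal_union _ _ hm Finset.sdiff_disjoint]
  congr 1
  funext x
  set y := B.play l σ x with hy
  set d := (σ D).act ((B.pa D).restrict y) with hd
  have hplay : B.play (l ++ [D]) σ x = Function.update y D d := B.play_append_singleton l D σ x
  have hunused : ∀ z, ∏ k ∈ G.factors \ B.usedFactors G D,
      q k (Function.updateFinset (Function.update y D d) (B.Xc G D) z) =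
      ∏ k ∈ G.factors \ B.usedFactors G D, q k y := by
    intro z
    refine Finset.prod_congr rfl fun k hk => hq k fun v hv => ?_
    obtain ⟨hk, hk'⟩ := Finset.mem_sdiff.1 hk
    have hv' := Finset.disjoint_left.1 (disjoint_family_of_notMem_usedFactors hk hk') hv
    simp only [Finset.mem_insert, not_or] at hv'
    simp [Function.updateFinset, hv'.1, hv'.2]
  have hred : B.reduceValue G D ψ q (σ D).act y =
      lmarginal B.ν (B.Xc G D) (B.augWeight G D ψ q) (Function.update y D d) := rfl
  rw [hred]
  unfold lmarginal
  have hwm : Measurable fun z => B.augWeight G D ψ q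
      (Function.updateFinset (Function.update y D d) (B.Xc G D) z) :=
    (hG.measurable_augWeight hqm).comp measurable_updateFinset
  -- The product of the unused factors is constant in `z` and may be moved back under the integral.
  rw [← lintegral_mul_const _ hwm]
  refine lintegral_congr fun z => ?_
  dsimp only
  rw [B.play_updateFinset σ hXc hpa, hplay, ← hunused z, augWeight, mul_assoc,
    mul_comm (∏ k ∈ B.usedFactors G D, _), Finset.prod_sdiff usedFactors_subset]

/-- The factors which are used do not depend on the probabilities elsewhere. -/
theorem augWeight_congr (h : ∀ k ∈ B.usedFactors G D, p k = q k) :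
    B.augWeight G D ψ p = B.augWeight G D ψ q := by
  funext x
  unfold augWeight
  rw [Finset.prod_congr rfl fun k hk => by rw [h k hk]]

theorem reduceValue_congr (h : ∀ k ∈ B.usedFactors G D, p k = q k)
    (f : (∀ w : B.pa D, X w) → X D) :
    B.reduceValue G D ψ p f = B.reduceValue G D ψ q f := by
  funext x
  unfold reduceValue
  rw [augWeight_congr h]

/-- After elimination of X_c(D) the mode rule wins pointwise under the outer integral. Only the used
factors enter the comparison, so `q` may differ from `p` elsewhere. -/
theorem reducedUtility_append_le (hG : B.Coherent (l ++ [D]) G ψ)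
    (hrec : B.PerfectRecall (l ++ [D]) C) (hC : G.chance ⊆ C)
    (hq : ∀ k, DependsOn (q k) (B.family k : Set V)) (hqm : ∀ k, Measurable (q k))
    (hpq : ∀ k ∈ B.usedFactors G D, p k = q k) {f : (∀ w : B.pa D, X w) → X D}
    (hf : B.IsModeRule G D ψ p f) (σ : B.Policy) (x₀ : ∀ v, X v) :
    B.reducedUtility (l ++ [D]) G ψ q σ x₀ ≤
      B.reducedUtility l (B.reduceDiagram G D) (B.reduceValue G D ψ p f) q σ x₀ := by
  rw [reducedUtility_append hG hrec hC hq hqm]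
  refine lmarginal_mono (fun x => ?_) x₀
  refine mul_le_mul_left ?_ _
  rw [← reduceValue_congr hpq]
  exact (B.isModeRule_iff G D ψ p f).1 hf _ _

/-- No maximality is involved: the value function is built from the policy's own rule at `D`. -/
theorem reducedUtility_append_eq (hG : B.Coherent (l ++ [D]) G ψ)
    (hrec : B.PerfectRecall (l ++ [D]) C) (hC : G.chance ⊆ C)
    (hq : ∀ k, DependsOn (q k) (B.family k : Set V)) (hqm : ∀ k, Measurable (q k))
    (hpq : ∀ k ∈ B.usedFactors G D, p k = q k) (σ : B.Policy) (x₀ : ∀ v, X v) :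
    B.reducedUtility (l ++ [D]) G ψ q σ x₀ =
      B.reducedUtility l (B.reduceDiagram G D) (B.reduceValue G D ψ p (σ D).act) q σ x₀ := by
  rw [reducedUtility_append hG hrec hC hq hqm, reduceValue_congr hpq]
  rfl

end Step

/-- The diagram `G`, with decision path `l` and value function `ψ`, results from APS reductions at
the decisions in `done`, where the rules `st` have been stored. -/
structure IsReduction (B : BAID V X Ω) (path : List V) (C : Finset V) (u : (∀ v, X v) → ℝ≥0∞)
    (p : V → (∀ v, X v) → ℝ≥0∞) (st : ∀ v, Option (Rule X (B.pa v) v)) (l done : List V)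
    (G : Diagram V) (ψ : (∀ v, X v) → ℝ≥0∞) : Prop where
  path_eq : path = l ++ done
  chance_subset : G.chance ⊆ C
  coherent : B.Coherent l G ψ
  stored : ∀ v ∈ done, (st v).isSome
  -- The quantifier over `q` makes the statement stable under later changes of unused probabilities.
  le : ∀ q : V → (∀ v, X v) → ℝ≥0∞, (∀ k, DependsOn (q k) (B.family k : Set V)) →
    (∀ k, Measurable (q k)) → (∀ k ∈ C \ G.factors, p k = q k) → ∀ σ x₀,
    B.expectedUtility path C u q σ x₀ ≤ B.reducedUtility l G ψ q σ x₀
  eq : ∀ q : V → (∀ v, X v) → ℝ≥0∞, (∀ k, DependsOn (q k) (B.family k : Set V)) →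
    (∀ k, Measurable (q k)) → (∀ k ∈ C \ G.factors, p k = q k) → ∀ σ x₀,
    (∀ v ∈ done, st v = some (σ v)) →
    B.expectedUtility path C u q σ x₀ = B.reducedUtility l G ψ q σ x₀
  -- Carried through the induction because `le` and `eq` compare only at the current stage; the
  -- diagrams of the earlier steps, which handle shorter suffixes, are not retained.
  stagewise : ∀ q : V → (∀ v, X v) → ℝ≥0∞, (∀ k, DependsOn (q k) (B.family k : Set V)) →
    (∀ k, Measurable (q k)) → (∀ k ∈ C \ G.factors, p k = q k) → ∀ δ : B.Policy,
    (∀ v ∈ done, st v = some (δ v)) → ∀ l', l' <:+ done → ∀ σ x₀,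
    B.expectedUtility path C u q σ x₀ ≤ B.expectedUtility path C u q (B.replaceOn l' σ δ) x₀

/-! ### Chains of APS reductions -/

namespace IsReduction

variable {B : BAID V X Ω} {path l done : List V} {C : Finset V} {u : (∀ v, X v) → ℝ≥0∞}
  {p p' : V → (∀ v, X v) → ℝ≥0∞} {st : ∀ v, Option (Rule X (B.pa v) v)} {G : Diagram V}
  {ψ : (∀ v, X v) → ℝ≥0∞}

theorem initial {val : Finset V}
    (hfam : ∀ k ∈ C, ∀ v ∈ B.family k, v ∈ C ∨ v ∈ path) (hval : ∀ v ∈ val, v ∈ C ∨ v ∈ path)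
    (hu : Measurable u) (hdep : DependsOn u (val : Set V)) :
    B.IsReduction path C u p st path [] ⟨C, C, val⟩ u where
  path_eq := by simp
  chance_subset := subset_rfl
  coherent := ⟨hfam, hval, hu, hdep⟩
  stored := by simp
  le _ _ _ _ _ _ := le_rfl
  eq _ _ _ _ _ _ _ := rfl
  stagewise q _ _ _ δ _ l' hl' σ x₀ := by
    rw [List.suffix_nil.1 hl']
    exact (congrArg (fun δ => B.expectedUtility path C u q δ x₀)
      (funext fun v => by simp [replaceOn])).le

/-- Probabilities which have not been used may be changed. -/
theorem congr_prob (h : B.IsReduction path C u p st l done G ψ)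
    (hp : ∀ k ∈ C \ G.factors, p' k = p k) : B.IsReduction path C u p' st l done G ψ where
  path_eq := h.path_eq
  chance_subset := h.chance_subset
  coherent := h.coherent
  stored := h.stored
  le q hq hqm hpq := h.le q hq hqm fun k hk => (hp k hk).symm.trans (hpq k hk)
  eq q hq hqm hpq := h.eq q hq hqm fun k hk => (hp k hk).symm.trans (hpq k hk)
  stagewise q hq hqm hpq := h.stagewise q hq hqm fun k hk => (hp k hk).symm.trans (hpq k hk)

/-- Replacing the rules at the reduced decisions by the stored ones is an improvement. -/
theorem le_of_stored (h : B.IsReduction path C u p st l done G ψ)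
    {q : V → (∀ v, X v) → ℝ≥0∞}
    (hq : ∀ k, DependsOn (q k) (B.family k : Set V)) (hqm : ∀ k, Measurable (q k))
    (hpq : ∀ k ∈ C \ G.factors, p k = q k) {σ τ : B.Policy} (hτ : ∀ v ∈ done, st v = some (τ v))
    (hστ : ∀ v ∈ l, σ v = τ v) (x₀ : ∀ v, X v) :
    B.expectedUtility path C u q σ x₀ ≤ B.expectedUtility path C u q τ x₀ := by
  rw [h.eq q hq hqm hpq τ x₀ hτ, ← B.reducedUtility_congr G ψ q hστ]
  exact h.le q hq hqm hpq σ x₀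

/-- An APS reduction at the last remaining decision. -/
theorem step {D : V} (h : B.IsReduction path C u p st (l ++ [D]) done G ψ)
    (hrec : B.PerfectRecall path C) (hfac : G.factors ⊆ C)
    (hp : ∀ k, DependsOn (p k) (B.family k : Set V)) (hpm : ∀ k, Measurable (p k))
    (r : Rule X (B.pa D) D) (hr : B.IsModeRule G D ψ p r.act)
    {st' : ∀ v, Option (Rule X (B.pa v) v)} (hst : ∀ v, v ≠ D → st' v = st v)
    (hD : st' D = some r) :
    B.IsReduction path C u p st' l (D :: done) (B.reduceDiagram G D)
      (B.reduceValue G D ψ p r.act) := by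
  have hrec' : B.PerfectRecall (l ++ [D]) C := by
    have := h.path_eq ▸ hrec
    exact this.of_append
  have hne : ∀ v ∈ done, v ≠ D := by
    rintro v hv rfl
    have := h.path_eq ▸ hrec.nodup
    exact (List.disjoint_of_nodup_append this) (by simp) hv
  have hold : ∀ {σ : B.Policy}, (∀ v ∈ D :: done, st' v = some (σ v)) →
      ∀ v ∈ done, st v = some (σ v) := fun hσ v hv => by
    rw [← hst v (hne v hv)]
    exact hσ v (by simp [hv])
  -- Agreement at the factors used after the step contains agreement at those used before it and at
  -- those absorbed in it.
  have hsub : ∀ q : V → (∀ v, X v) → ℝ≥0∞,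
      (∀ k ∈ C \ (B.reduceDiagram G D).factors, p k = q k) →
      (∀ k ∈ C \ G.factors, p k = q k) ∧ ∀ k ∈ B.usedFactors G D, p k = q k := by
    intro q hpq
    refine ⟨fun k hk => hpq k ?_, fun k hk => hpq k ?_⟩
    · simp only [Finset.mem_sdiff, reduceDiagram] at hk ⊢
      exact ⟨hk.1, fun hk' => hk.2 hk'.1⟩
    · simp only [Finset.mem_sdiff, reduceDiagram]
      exact ⟨hfac (usedFactors_subset hk), fun hk' => hk'.2 hk⟩
  have hle : ∀ q : V → (∀ v, X v) → ℝ≥0∞, (∀ k, DependsOn (q k) (B.family k : Set V)) →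
      (∀ k, Measurable (q k)) →
      (∀ k ∈ C \ (B.reduceDiagram G D).factors, p k = q k) → ∀ σ x₀,
      B.expectedUtility path C u q σ x₀ ≤
        B.reducedUtility l (B.reduceDiagram G D) (B.reduceValue G D ψ p r.act) q σ x₀ :=
    fun q hq hqm hpq σ x₀ => (h.le q hq hqm (hsub q hpq).1 σ x₀).trans
      (reducedUtility_append_le h.coherent hrec' h.chance_subset hq hqm (hsub q hpq).2 hr σ x₀)
  have heq : ∀ q : V → (∀ v, X v) → ℝ≥0∞, (∀ k, DependsOn (q k) (B.family k : Set V)) →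
      (∀ k, Measurable (q k)) →
      (∀ k ∈ C \ (B.reduceDiagram G D).factors, p k = q k) → ∀ σ x₀,
      (∀ v ∈ D :: done, st' v = some (σ v)) →
      B.expectedUtility path C u q σ x₀ =
        B.reducedUtility l (B.reduceDiagram G D) (B.reduceValue G D ψ p r.act) q σ x₀ := by
    intro q hq hqm hpq σ x₀ hσ
    have hrD : r = σ D := by
      have := hσ D (by simp)
      rw [hD] at this
      exact Option.some.inj this
    rw [h.eq q hq hqm (hsub q hpq).1 σ x₀ (hold hσ), hrD]
    exact reducedUtility_append_eq h.coherent hrec' h.chance_subset hq hqm (hsub q hpq).2 σ x₀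
  exact
    { path_eq := by rw [h.path_eq]; simp
      chance_subset := Finset.sdiff_subset.trans h.chance_subset
      coherent := h.coherent.reduce hp hpm r hr
      stored := by
        intro v hv
        rcases List.mem_cons.1 hv with rfl | hv
        · simp [hD]
        · rw [hst v (hne v hv)]
          exact h.stored v hv
      le := hle
      eq := heq
      stagewise := by
        intro q hq hqm hpq δ hδ l' hl' σ x₀
        -- For the full suffix, the modified policy attains the bound just proved and coincides with
        -- `σ` on `l`. A shorter suffix was treated at an earlier step.
        rcases List.suffix_cons_iff.1 hl' with rfl | hl'
        · rw [heq q hq hqm hpq (B.replaceOn (D :: done) σ δ) x₀ fun v hv => by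
            simp only [replaceOn, hv, if_true]
            exact hδ v hv]
          refine (hle q hq hqm hpq σ x₀).trans (B.reducedUtility_congr _ _ _ ?_ _).le
          intro v hv
          have hv' : v ∉ D :: done := by
            have := h.path_eq ▸ hrec.nodup
            rw [List.append_assoc] at this
            exact fun hmem => (List.disjoint_of_nodup_append this) hv (by simpa using hmem)
          simp only [replaceOn, hv', if_false]
        · exact h.stagewise q hq hqm (hsub q hpq).1 δ (hold hδ) l' hl' σ x₀ }

end IsReduction

/-! ### Consequences of properness -/

theorem notMem_pa_self {B : BAID V X Ω} (hB : B.Proper) (v : V) : v ∉ B.pa v :=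
  fun h => hB.acyclic v (.single h)

theorem mem_chanceNodes {B : BAID V X Ω} {a : Agent} {v : V} :
    v ∈ B.chanceNodes a ↔ (B.kind v).isChanceFor a = true := by
  simp [chanceNodes]

theorem isChanceFor_decision_self (a : Agent) :
    (NodeKind.decision a).isChanceFor a = false := by
  cases a <;> rfl

theorem isChanceFor_or_decision {k : NodeKind} {a : Agent} (h : k.inDiagram a = true) :
    k.isChanceFor a = true ∨ k = .decision a := by
  rcases k with b | b | _ <;> cases a <;> (try cases b) <;> simp_all [NodeKind.inDiagram,
    NodeKind.isChanceFor, NodeKind.isOwnChance]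

theorem inDiagram_of_isChanceFor {k : NodeKind} {a : Agent} (h : k.isChanceFor a = true) :
    k.inDiagram a = true := by
  rcases k with b | b | _ <;> cases a <;> (try cases b) <;> simp_all [NodeKind.inDiagram,
    NodeKind.isChanceFor, NodeKind.isOwnChance]

theorem isOwnChance_or_decision {k : NodeKind} (h : k.isChanceFor .defender = true) :
    k.isOwnChance .defender = true ∨ k = .decision .attacker := by
  rcases k with b | b | _ <;> (try cases b) <;> simp_all [NodeKind.isChanceFor,
    NodeKind.isOwnChance]

theorem perfectRecall {B : BAID V X Ω} (hB : B.Proper) {a : Agent} {path : List V}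
    (hpath : B.IsDecisionPath a path) : B.PerfectRecall path (B.chanceNodes a) where
  nodup := hpath.nodup
  notMem v hv h := by
    rw [mem_chanceNodes, (hpath.mem_iff v).1 hv, isChanceFor_decision_self] at h
    exact Bool.false_ne_true h
  forall_subset := by
    have htrans : IsTrans V B.Precedes := ⟨fun _ _ _ => Relation.TransGen.trans⟩
    refine (List.isChain_iff_pairwise.1 hpath.chain).imp_of_mem fun {v w} hv hw h => ?_
    exact (hB.proper a).no_forgetting v w ((hpath.mem_iff v).1 hv) ((hpath.mem_iff w).1 hw) h
  irrefl := notMem_pa_self hB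

theorem mem_chanceNodes_or_path {B : BAID V X Ω} {a : Agent} {path : List V}
    (hpath : B.IsDecisionPath a path) {v : V} (h : (B.kind v).inDiagram a = true) :
    v ∈ B.chanceNodes a ∨ v ∈ path := by
  rw [mem_chanceNodes, hpath.mem_iff]
  exact isChanceFor_or_decision h

theorem isReduction_initial {B : BAID V X Ω} (hB : B.Proper) {a : Agent} {path : List V}
    (hpath : B.IsDecisionPath a path) {u : (∀ v, X v) → ℝ≥0∞} (hu : Measurable u)
    (hdep : DependsOn u (B.uPa a : Set V)) (p : V → (∀ v, X v) → ℝ≥0∞)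
    (st : ∀ v, Option (Rule X (B.pa v) v)) :
    B.IsReduction path (B.chanceNodes a) u p st path [] (B.initDiagram a) u := by
  refine .initial (fun k hk v hv => ?_) (fun v hv => ?_) hu hdep
  · rcases Finset.mem_insert.1 hv with rfl | hv
    · exact Or.inl hk
    · exact mem_chanceNodes_or_path hpath
        ((hB.proper a).pa_mem k (inDiagram_of_isChanceFor (mem_chanceNodes.1 hk)) v hv)
  · exact mem_chanceNodes_or_path hpath ((hB.proper a).uPa_mem v hv)

/-! ### The invariant of the algorithm -/

/-- The random rules stored in `s`, for the outcome `ω`. -/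
def storedAt (B : BAID V X Ω) (s : B.State) (ω : Ω) (v : V) : Option (Rule X (B.pa v) v) :=
  (s.aStar v).map fun r => r.at ω

/-- What holds in a state reached after reductions at the Defender's decisions `doneD` and at the
Attacker's decisions `doneA`. -/
structure Invariant (B : BAID V X Ω) (ddp adp : List V) (s : B.State) (doneD doneA : List V) :
    Prop where
  redD : B.IsReduction ddp (B.chanceNodes .defender) B.utilD (B.evalD s.pD) s.dStar s.ddp doneD
    s.diagD s.ψD
  redA : ∀ᵐ ω ∂B.P, B.IsReduction adp (B.chanceNodes .attacker) (B.utilA ω) (B.evalA s.pA ω)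
    (B.storedAt s ω) s.adp doneA s.diagA (s.ψA ω)
  adp_eq : adp = s.adp ++ doneA
  factorsD : s.diagD.factors ⊆ B.chanceNodes .defender
  factorsA : s.diagA.factors ⊆ B.chanceNodes .attacker
  measurable_ψA : Measurable fun z : Ω × (∀ v, X v) => s.ψA z.1 z.2
  -- Together with `pD_none` this keeps a new forecast from touching a factor the Defender has
  -- already used.
  used : ∀ k ∈ B.chanceNodes .defender \ s.diagD.factors, (s.pD k).isSome
  pD_none : ∀ v ∈ s.adp, s.pD v = none
  dStar_none : ∀ v ∈ s.ddp, s.dStar v = none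
  pD_done : ∀ v ∈ doneA, (s.pD v).isSome
  forecast : ∀ v q, B.kind v = .decision .attacker → s.pD v = some q →
    ∃ r, s.aStar v = some r ∧ B.IsForecast v r q
  stored : ∀ v r, s.aStar v = some r → B.kind v = .decision .attacker ∧
    ∃ q, s.pD v = some q ∧ B.IsForecast v r q
  original : ∀ v (h : (B.kind v).isOwnChance .defender = true), s.pD v = some (B.pD v h)
  beliefs : ∀ v (h : (B.kind v).isChanceFor .attacker = true), s.pA v = some (B.PA v h) ∨
    ∃ (hv : B.kind v = .decision .defender) (r : Rule X (B.pa v) v), s.dStar v = some r ∧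
      s.pA v = some (B.reassess v hv r)

/-! ### Preservation of the invariant along a run -/

section

variable {B : BAID V X Ω} {ddp adp doneD doneA : List V} {s t : B.State}

theorem invariant_initial (hB : B.Proper) (hddp : B.IsDecisionPath .defender ddp)
    (hadp : B.IsDecisionPath .attacker adp) :
    B.Invariant ddp adp (B.initState ddp adp) [] [] where
  redD := isReduction_initial hB hddp B.measurable_utilD B.dependsOn_utilD _ _
  redA := ae_of_all _ fun ω => isReduction_initial hB hadp
    (B.measurable_utilA.comp measurable_prodMk_left) (B.dependsOn_utilA ω) _ _
  adp_eq := by simp [initState]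
  factorsD := subset_rfl
  factorsA := subset_rfl
  measurable_ψA := B.measurable_utilA
  used := by simp [initState, initDiagram]
  pD_none v hv := by
    have : (B.kind v).isOwnChance .defender = false := by
      rw [(hadp.mem_iff v).1 hv]; rfl
    simp [initState, this]
  dStar_none _ _ := rfl
  pD_done := by simp
  forecast v q hv h := by simp [initState, hv, NodeKind.isOwnChance] at h
  stored v r h := by simp [initState] at h
  original v h := by simp [initState, h]
  beliefs v h := Or.inl (by simp [initState, h])

theorem measurable_lmarginal_augWeight {G : Diagram V} {D : V} {ψ : Ω → (∀ v, X v) → ℝ≥0∞}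
    (hψ : Measurable fun z : Ω × (∀ v, X v) => ψ z.1 z.2) (p : B.AttProbs) :
    Measurable fun z : Ω × (∀ v, X v) =>
      lmarginal B.ν (B.Xc G D) (B.augWeight G D (ψ z.1) (B.evalA p z.1)) z.2 :=
  measurable_lmarginal_param (f := fun ω => B.augWeight G D (ψ ω) (B.evalA p ω))
    (hψ.mul (Finset.measurable_prod _ fun k _ => B.measurable_evalA p k))

/-- The Defender's diagram is reduced by `IsReduction.step`; the Attacker's survives because a
belief is reassessed only while it is an unused factor there. -/
theorem Invariant.daps (hI : B.Invariant ddp adp s doneD doneA) (hB : B.Proper)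
    (hddp : B.IsDecisionPath .defender ddp) (hst : B.DapsStep s t) :
    ∃ D, B.Invariant ddp adp t (D :: doneD) doneA := by
  obtain ⟨l, D, hl, hD, hav, r, hr⟩ := hst
  have hrecD := perfectRecall hB hddp
  have hDl : D ∉ l := by
    have := hI.redD.path_eq ▸ hddp.nodup
    rw [hl] at this
    exact fun h => (List.disjoint_of_nodup_append this.of_append_left) h (by simp)
  have hnone : s.dStar D = none := hI.dStar_none D (by simp [hl])
  refine ⟨D, ?_⟩
  exact
    { redD := by
        have h := hI.redD
        rw [hl] at h
        exact h.step hrecD hI.factorsD (B.dependsOn_evalD _) (B.measurable_evalD _) r hr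
          (fun v hv => by simp [hv]) (by simp)
      redA := by
        filter_upwards [hI.redA] with ω h
        refine h.congr_prob fun k hk => ?_
        funext x
        dsimp only [evalA, updateBeliefs]
        split_ifs with hDf
        · have hne : k ≠ D := by
            rintro rfl
            exact (Finset.mem_sdiff.1 hk).2 hDf
          rw [Function.update_of_ne hne]
        · rfl
      adp_eq := hI.adp_eq
      factorsD := Finset.sdiff_subset.trans hI.factorsD
      factorsA := hI.factorsA
      measurable_ψA := hI.measurable_ψA
      used := by
        intro k hk
        by_cases hk' : k ∈ s.diagD.factors
        · refine hav k ?_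
          by_contra hu
          exact (Finset.mem_sdiff.1 hk).2 (Finset.mem_sdiff.2 ⟨hk', hu⟩)
        · exact hI.used k (Finset.mem_sdiff.2 ⟨(Finset.mem_sdiff.1 hk).1, hk'⟩)
      pD_none := hI.pD_none
      dStar_none := by
        intro v hv
        have hne : v ≠ D := by
          rintro rfl
          exact hDl hv
        dsimp only
        rw [Function.update_of_ne hne]
        exact hI.dStar_none v (by simp [hl, show v ∈ l from hv])
      pD_done := hI.pD_done
      forecast := hI.forecast
      stored := hI.stored
      original := hI.original
      beliefs := by
        intro v h
        dsimp only [updateBeliefs]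
        by_cases hv : v = D
        · subst hv
          split_ifs with hDf
          · exact Or.inr ⟨hD, r, by simp, by simp⟩
          -- A reassessed belief would come with a rule stored at this node, but none was stored
          -- before this step.
          · refine Or.inl ((hI.beliefs v h).resolve_right ?_)
            rintro ⟨_, r', hr', _⟩
            simp [hnone] at hr'
        · have hpA : (if D ∈ s.diagA.factors then
              Function.update s.pA D (some (B.reassess D hD r)) else s.pA) v = s.pA v := by
            split_ifs
            · rw [Function.update_of_ne hv]
            · rfl
          rw [hpA, Function.update_of_ne hv]
          exact hI.beliefs v h }

/-- The mirror image: for almost every outcome the Attacker's diagram is reduced, while the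
Defender's survives because her used factors all had densities and `A` had none. -/
theorem Invariant.aaps (hI : B.Invariant ddp adp s doneD doneA) (hB : B.Proper)
    (hadp : B.IsDecisionPath .attacker adp) (hst : B.AapsStep s t) :
    ∃ A, B.Invariant ddp adp t doneD (A :: doneA) := by
  obtain ⟨l, l', D, A, hl, hav, hl', r, hr, q, hq⟩ := hst
  have hrecA := perfectRecall hB hadp
  have hA : B.kind A = .decision .attacker :=
    (hadp.mem_iff A).1 (by rw [hI.adp_eq, hl']; simp)
  have hnd : (l' ++ [A] ++ doneA).Nodup := by
    rw [← hl', ← hI.adp_eq]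
    exact hadp.nodup
  have hAl : A ∉ l' := fun h => (List.disjoint_of_nodup_append hnd.of_append_left) h (by simp)
  have hnone : s.pD A = none := hI.pD_none A (by simp [hl'])
  refine ⟨A, ?_⟩
  exact
    { redD := by
        refine hI.redD.congr_prob fun k hk => ?_
        have hne : k ≠ A := by
          rintro rfl
          have := hI.used k hk
          simp [hnone] at this
        funext x
        dsimp only [evalD]
        rw [Function.update_of_ne hne]
      redA := by
        filter_upwards [hI.redA, hr] with ω h hrω
        rw [hl'] at h
        exact h.step hrecA hI.factorsA (B.dependsOn_evalA _ ω)
          (fun k => (B.measurable_evalA _ k).comp measurable_prodMk_left) (r.at ω) hrω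
          (fun v hv => by simp [storedAt, hv]) (by simp [storedAt])
      adp_eq := by rw [hI.adp_eq, hl']; simp
      factorsD := hI.factorsD
      factorsA := Finset.sdiff_subset.trans hI.factorsA
      measurable_ψA := by
        refine (measurable_lmarginal_augWeight hI.measurable_ψA s.pA).comp
          (measurable_fst.prodMk (measurable_update_param measurable_snd ?_))
        exact r.measurable_act.comp
          (measurable_fst.prodMk ((Finset.measurable_restrict _).comp measurable_snd))
      used := by
        intro k hk
        dsimp only
        by_cases hk' : k = A
        · subst hk'; simp
        · rw [Function.update_of_ne hk']
          exact hI.used k hk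
      pD_none := by
        intro v hv
        have hne : v ≠ A := by
          rintro rfl
          exact hAl hv
        dsimp only
        rw [Function.update_of_ne hne]
        exact hI.pD_none v (by simp [hl', show v ∈ l' from hv])
      dStar_none := hI.dStar_none
      pD_done := by
        intro v hv
        dsimp only
        by_cases hvA : v = A
        · subst hvA; simp
        · rw [Function.update_of_ne hvA]
          exact hI.pD_done v ((List.mem_cons.1 hv).resolve_left hvA)
      forecast := by
        intro v q' hv hq'
        dsimp only at hq' ⊢
        by_cases hvA : v = A
        · subst hvA
          rw [Function.update_self, Option.some.injEq] at hq'
          exact ⟨r, by simp, hq' ▸ hq⟩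
        · rw [Function.update_of_ne hvA] at hq' ⊢
          exact hI.forecast v q' hv hq'
      stored := by
        intro v r' hr'
        dsimp only at hr' ⊢
        by_cases hvA : v = A
        · subst hvA
          rw [Function.update_self, Option.some.injEq] at hr'
          exact ⟨hA, q, by simp, hr' ▸ hq⟩
        · rw [Function.update_of_ne hvA] at hr' ⊢
          exact hI.stored v r' hr'
      original := by
        intro v h
        have hvA : v ≠ A := by
          rintro rfl
          rw [hA] at h
          exact Bool.false_ne_true h
        dsimp only
        rw [Function.update_of_ne hvA]
        exact hI.original v h
      beliefs := hI.beliefs }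

theorem exists_invariant (hB : B.Proper) (hddp : B.IsDecisionPath .defender ddp)
    (hadp : B.IsDecisionPath .attacker adp) {i j : ℕ} {s₀ : B.State} (hrun : B.Run i j s₀ s)
    (hs₀ : s₀ = B.initState ddp adp) :
    ∃ doneD doneA : List V, doneD.length = i ∧ doneA.length = j ∧
      B.Invariant ddp adp s doneD doneA := by
  induction hrun with
  | refl =>
    subst hs₀
    exact ⟨[], [], rfl, rfl, invariant_initial hB hddp hadp⟩
  | daps _ hs ih =>
    obtain ⟨dD, dA, hi, hj, hI⟩ := ih hs₀
    obtain ⟨D, hI'⟩ := hI.daps hB hddp hs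
    exact ⟨_, _, by simp [hi], hj, hI'⟩
  | aaps _ hs ih =>
    obtain ⟨dD, dA, hi, hj, hI⟩ := ih hs₀
    obtain ⟨A, hI'⟩ := hI.aaps hB hadp hs
    exact ⟨_, _, hi, by simp [hj], hI'⟩

/-- A distribution which is needed but not available belongs to a remaining decision of the
Attacker. -/
theorem Invariant.adp_ne_nil (hI : B.Invariant ddp adp s doneD doneA)
    (hadp : B.IsDecisionPath .attacker adp) {D : V} (hav : ¬ B.Available s D) : s.adp ≠ [] := by
  intro hnil
  refine hav fun k hk => ?_
  rcases isOwnChance_or_decision (mem_chanceNodes.1 (hI.factorsD (usedFactors_subset hk)))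
    with h | h
  · simp [hI.original k h]
  · refine hI.pD_done k ?_
    have := (hadp.mem_iff k).2 h
    rwa [hI.adp_eq, hnil, List.nil_append] at this

theorem Invariant.progress (hI : B.Invariant ddp adp s doneD doneA)
    (hddp : B.IsDecisionPath .defender ddp) (hadp : B.IsDecisionPath .attacker adp)
    (hne : s.ddp ≠ []) (hsol : B.Solvable s) : ∃ s', B.DapsStep s s' ∨ B.AapsStep s s' := by
  obtain ⟨l, D, hl⟩ := (List.eq_nil_or_concat' s.ddp).resolve_left hne
  have hD : B.kind D = .decision .defender :=
    (hddp.mem_iff D).1 (by rw [hI.redD.path_eq, hl]; simp)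
  by_cases hav : B.Available s D
  · obtain ⟨r, hr⟩ := (hsol l D hl).1 hav
    exact ⟨_, Or.inl (.mk s l D hl hD hav r hr)⟩
  · obtain ⟨l', A, hl'⟩ := (List.eq_nil_or_concat' s.adp).resolve_left (hI.adp_ne_nil hadp hav)
    obtain ⟨r, q, hr, hq⟩ := (hsol l D hl).2 hav l' A hl'
    exact ⟨_, Or.inr (.mk s l l' D A hl hav hl' r hr q hq)⟩

/-! ### Optimality -/

theorem Invariant.isOptimalOutput (hI : B.Invariant ddp adp s doneD doneA)
    (hs : s.ddp = []) : B.IsOptimalOutput ddp adp s where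
  forecast := hI.forecast
  stored := hI.stored
  original := hI.original
  beliefs := hI.beliefs
  attacker := by
    filter_upwards [hI.redA] with ω h σ x₀
    have hsome : ∀ v ∈ doneA, B.storedAt s ω v = some (B.replaceStored s ω σ v) := by
      intro v hv
      have := h.stored v hv
      simp only [storedAt, replaceStored] at this ⊢
      cases hv' : s.aStar v <;> simp_all
    refine h.le_of_stored (B.dependsOn_evalA _ ω)
      (fun k => (B.measurable_evalA _ k).comp measurable_prodMk_left) (fun _ _ => rfl) hsome
      (fun v hv => ?_) x₀
    -- A stored rule comes with a forecast, and the unreduced decisions have none; so the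
    -- replacement leaves them alone.
    have : s.aStar v = none := by
      rw [Option.eq_none_iff_forall_not_mem]
      intro r hr
      obtain ⟨_, q, hq, _⟩ := hI.stored v r hr
      simp [hI.pD_none v hv] at hq
    simp [replaceStored, this]
  defender := by
    have hpath : ddp = doneD := by simpa [hs] using hI.redD.path_eq
    have : ∀ v, Nonempty (X v) := B.nonempty_value
    -- The constant rules serve only as fillers at nodes without a stored rule; every node of the
    -- DDP has one.
    let δ : B.Policy := fun v => (s.dStar v).getD ⟨fun _ => Classical.arbitrary _,
      measurable_const⟩
    have hδ : ∀ v ∈ doneD, s.dStar v = some (δ v) := by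
      intro v hv
      obtain ⟨r, hr⟩ := Option.isSome_iff_exists.1 (hI.redD.stored v hv)
      simp [δ, hr]
    refine ⟨δ, fun v hv => hδ v (hpath ▸ hv), fun p hp δ' x₀ => ?_⟩
    -- Used factors are available, and a completion keeps all available densities.
    have hpq : ∀ k ∈ B.chanceNodes .defender \ s.diagD.factors,
        B.evalD s.pD k = B.evalD p k := by
      intro k hk
      obtain ⟨q, hq⟩ := Option.isSome_iff_exists.1 (hI.used k hk)
      funext x
      simp only [evalD, hq, hp.1 k q hq]
    refine ⟨?_, fun l l' hl => ?_⟩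
    · exact hI.redD.le_of_stored (B.dependsOn_evalD p) (B.measurable_evalD p) hpq hδ
        (by simp [hs]) x₀
    · exact hI.redD.stagewise _ (B.dependsOn_evalD p) (B.measurable_evalD p) hpq δ hδ l'
        ⟨l, by rw [← hpath, hl]⟩ δ' x₀

/-! ### Finite decision sets -/

/-- The extension of a partial configuration by arbitrary values. -/
def extend (B : BAID V X Ω) (S : Finset V) (c : ∀ w : S, X w) : ∀ v, X v :=
  Function.updateFinset (fun v => (B.nonempty_value v).some) S c

theorem measurable_extend (S : Finset V) : Measurable (B.extend S) :=
  measurable_updateFinset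

theorem extend_restrict {S : Finset V} (x : ∀ v, X v) {v : V} (hv : v ∈ S) :
    B.extend S (S.restrict x) v = x v := by
  simp [extend, Function.updateFinset, hv]

/-- A rule which maximises the weight for configurations extending the known values is a mode
rule. -/
theorem Coherent.isModeRule {l : List V} {D : V} {C : Finset V} {G : Diagram V}
    {ψ : (∀ v, X v) → ℝ≥0∞} {p : V → (∀ v, X v) → ℝ≥0∞} (hG : B.Coherent (l ++ [D]) G ψ)
    (hrec : B.PerfectRecall (l ++ [D]) C) (hp : ∀ k, DependsOn (p k) (B.family k : Set V))
    {f : (∀ w : B.pa D, X w) → X D}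
    (hf : ∀ c d, lmarginal B.ν (B.Xc G D) (B.augWeight G D ψ p)
      (Function.update (B.extend (B.pa D) c) D d) ≤
        lmarginal B.ν (B.Xc G D) (B.augWeight G D ψ p)
      (Function.update (B.extend (B.pa D) c) D (f c))) : B.IsModeRule G D ψ p f := by
  rw [isModeRule_iff]
  intro x d
  have hext : ∀ e, lmarginal B.ν (B.Xc G D) (B.augWeight G D ψ p)
      (Function.update (B.extend (B.pa D) ((B.pa D).restrict x)) D e) =
      lmarginal B.ν (B.Xc G D) (B.augWeight G D ψ p) (Function.update x D e) :=
    fun e => hG.dependsOn_marginal hrec hp e fun v hv => extend_restrict x hv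
  have h := hf ((B.pa D).restrict x) d
  rwa [hext, hext] at h

/-- A random decision with finitely many values has a density with respect to a measure which
charges all of them. -/
theorem exists_isForecast {A : V} [Finite (X A)] [MeasurableSingletonClass (X A)]
    (hν : ∀ x, B.ν A {x} ≠ 0) (r : RandRule X Ω (B.pa A) A) : ∃ q, B.IsForecast A r q := by
  have hact : ∀ c, Measurable fun ω => r.act ω c := fun c =>
    r.measurable_act.comp measurable_prodMk_right
  let g : (∀ w : B.pa A, X w) → X A → ℝ≥0∞ := fun c a =>
    B.P {ω | r.act ω c = a} / B.ν A {a}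
  have hg : ∀ c a, g c a ≠ ∞ := fun c a =>
    ENNReal.div_ne_top (measure_ne_top _ _) (hν a)
  have hgm : Measurable fun z : (∀ w : B.pa A, X w) × X A => (g z.1 z.2).toNNReal := by
    refine measurable_from_prod_countable_left fun a => ?_
    have hset : MeasurableSet {z : Ω × (∀ w : B.pa A, X w) | r.act z.1 z.2 = a} :=
      r.measurable_act (measurableSet_singleton a)
    have hP : Measurable fun c => B.P ((fun ω => (ω, c)) ⁻¹'
        {z : Ω × (∀ w : B.pa A, X w) | r.act z.1 z.2 = a}) :=
      measurable_measure_prodMk_right hset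
    have hdiv : Measurable fun c => g c a := hP.div_const _
    exact hdiv.ennreal_toNNReal
  have hmap : ∀ c, B.P.map (fun ω => r.act ω c) =
      (B.ν A).withDensity fun a => ((g c a).toNNReal : ℝ≥0∞) := by
    intro c
    refine Measure.ext_of_singleton fun a => ?_
    rw [Measure.map_apply (hact c) (measurableSet_singleton a),
      withDensity_apply _ (measurableSet_singleton a), lintegral_singleton,
      ENNReal.coe_toNNReal (hg c a)]
    -- Singletons have finite reference measure by σ-finiteness, and positive measure by assumption,
    -- so the quotient cancels.
    exact (ENNReal.div_mul_cancel (hν a) measure_singleton_lt_top.ne).symm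
  refine ⟨⟨fun c a => (g c a).toNNReal, hgm, fun c => ?_⟩, hmap⟩
  rw [← setLIntegral_univ, ← withDensity_apply _ MeasurableSet.univ, ← hmap,
    Measure.map_apply (hact c) MeasurableSet.univ, Set.preimage_univ, measure_univ]

/-- With finitely many actions the maximum is attained; measurability of the rule comes from
`exists_measurable_argmax` applied to the marginal as a function of the known values. -/
theorem Invariant.solvable (hI : B.Invariant ddp adp s doneD doneA) (hB : B.Proper)
    (hddp : B.IsDecisionPath .defender ddp) (hadp : B.IsDecisionPath .attacker adp)
    (hfin : B.FiniteDecisions) : B.Solvable s := by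
  intro l D hl
  constructor
  · intro _
    have hpath : ddp = l ++ [D] ++ doneD := hl ▸ hI.redD.path_eq
    have hG : B.Coherent (l ++ [D]) s.diagD s.ψD := hl ▸ hI.redD.coherent
    have hrec : B.PerfectRecall (l ++ [D]) (B.chanceNodes .defender) :=
      (hpath ▸ perfectRecall hB hddp).of_append
    have hD : B.kind D = .decision .defender := (hddp.mem_iff D).1 (by simp [hpath])
    have := (hfin D _ hD).1
    have := B.nonempty_value D
    obtain ⟨f, hf, hmax⟩ := exists_measurable_argmax
      (fun (d : X D) (c : ∀ w : B.pa D, X w) =>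
        lmarginal B.ν (B.Xc s.diagD D) (B.augWeight s.diagD D s.ψD (B.evalD s.pD))
          (Function.update (B.extend (B.pa D) c) D d))
      (fun d => ((hG.measurable_augWeight (B.measurable_evalD s.pD)).lmarginal B.ν).comp
        (measurable_update_param (measurable_extend _) measurable_const))
    exact ⟨⟨f, hf⟩, hG.isModeRule hrec (B.dependsOn_evalD _) hmax⟩
  · intro _ l' A hl'
    have hpath : adp = l' ++ [A] ++ doneA := hl' ▸ hI.adp_eq
    have hrec : B.PerfectRecall (l' ++ [A]) (B.chanceNodes .attacker) :=
      (hpath ▸ perfectRecall hB hadp).of_append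
    have hA : B.kind A = .decision .attacker := (hadp.mem_iff A).1 (by simp [hpath])
    obtain ⟨_, _, hν⟩ := hfin A _ hA
    have := B.nonempty_value A
    -- The outcome and the known values form a single parameter, so the selected random rule is
    -- jointly measurable. It maximises for every outcome; coherence, needed to pass to all
    -- configurations, holds almost surely.
    obtain ⟨f, hf, hmax⟩ := exists_measurable_argmax
      (fun (d : X A) (z : Ω × ∀ w : B.pa A, X w) =>
        lmarginal B.ν (B.Xc s.diagA A) (B.augWeight s.diagA A (s.ψA z.1) (B.evalA s.pA z.1))
          (Function.update (B.extend (B.pa A) z.2) A d))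
      (fun d => (measurable_lmarginal_augWeight hI.measurable_ψA s.pA).comp
        (measurable_fst.prodMk (measurable_update_param
          ((measurable_extend _).comp measurable_snd) measurable_const)))
    let r : RandRule X Ω (B.pa A) A := ⟨fun ω c => f (ω, c), hf⟩
    obtain ⟨q, hq⟩ := exists_isForecast hν r
    refine ⟨r, q, ?_, hq⟩
    filter_upwards [hI.redA] with ω h
    have hG : B.Coherent (l' ++ [A]) s.diagA (s.ψA ω) := hl' ▸ h.coherent
    exact hG.isModeRule hrec (B.dependsOn_evalA _ ω) fun c d => hmax (ω, c) d

end

end BAID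

end

theorem proposition5 {V : Type*} [Fintype V] [DecidableEq V] {X : V → Type*}
    [∀ v, MeasurableSpace (X v)] {Ω : Type*} [MeasurableSpace Ω] (B : BAID V X Ω) (hB : B.Proper)
    (ddp adp : List V) (hddp : B.IsDecisionPath .defender ddp)
    (hadp : B.IsDecisionPath .attacker adp) :
    -- termination: at most `n` and `m` reductions, exactly `n` Defender reductions at the end
    (∀ i j s, B.Run i j (B.initState ddp adp) s →
      i ≤ ddp.length ∧ j ≤ adp.length ∧ (s.ddp = [] ↔ i = ddp.length)) ∧
    -- the algorithm proceeds as long as the maximum in the reduction that is due is attained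
    (∀ i j s, B.Run i j (B.initState ddp adp) s → s.ddp ≠ [] → B.Solvable s →
      ∃ s', B.DapsStep s s' ∨ B.AapsStep s s') ∧
    -- which is always the case if the decision sets are finite
    (B.FiniteDecisions → ∀ i j s, B.Run i j (B.initState ddp adp) s → B.Solvable s) ∧
    -- what it returns is the optimal policy
    (∀ i j s, B.Run i j (B.initState ddp adp) s → s.ddp = [] →
      B.IsOptimalOutput ddp adp s) := by
  refine ⟨fun i j s h => ?_, fun i j s h hne hsol => ?_, fun hfin i j s h => ?_,
    fun i j s h hs => ?_⟩ <;>
  obtain ⟨doneD, doneA, hi, hj, hI⟩ := BAID.exists_invariant hB hddp hadp h rfl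
  -- Each path splits into its remaining and its reduced decisions, and the latter are counted by
  -- `i` and `j`.
  · have hD := congrArg List.length hI.redD.path_eq
    have hA := congrArg List.length hI.adp_eq
    rw [List.length_append] at hD hA
    refine ⟨by omega, by omega, ?_⟩
    rw [← List.length_eq_zero_iff]
    omega
  · exact hI.progress hddp hadp hne hsol
  · exact hI.solvable hB hddp hadp hfin
  · exact hI.isOptimalOutput hs
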